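/- Let $q$ be a prime power, let $V$ be an $n$-dimensional vector space over the finite field $\mathbb F_q$, and let $1\le k\le n-1$. Let $X_V$ be the spherical building of $V$: its $p$-simplices ($p\ge -1$) are the chains $U_0\subsetneq\cdots\subsetneq U_p$ of linear subspaces with $0\ne U_0$ and $U_p\neq V$. Let $\mathfrak g$ be the local coefficient system on $X_V$ with $\mathfrak g(U_0\subsetneq\cdots\subsetneq U_p)=U_0$ and $\mathfrak g(\emptyset)=V$, whose connecting maps $\mathfrak g(\tau)\to\mathfrak g(\sigma)$ for $\sigma\subset\tau$ are the inclusions, and let $\wedge^k\mathfrak g$ be its $k$-th exterior power. Let $C_p(X_V;\wedge^k\mathfrak g)$ be the $\mathbb F_q$-space of formal sums $\sum_\sigma c(\sigma)\,\sigma$ over the $p$-simplices $\sigma$, with $c(\sigma)\in\wedge^k\mathfrak g(\sigma)$, with the boundary map $$\partial_p(c\,\sigma)=\sum_{i=0}^{p}(-1)^i\rho_i(c)\,\sigma_i ,$$ where $\sigma_i$ is obtained from $\sigma=(U_0\subsetneq\cdots\subsetneq U_p)$ by deleting $U_i$ and $\rho_i:\wedge^k\mathfrak g(\sigma)\to\wedge^k\mathfrak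 g(\sigma_i)$ is induced by inclusion; in particular $C_{-1}(X_V;\wedge^k\mathfrak g)=\wedge^kV$. Let $$\mathcal D^k(V)=\tilde H_{n-k-1}(X_V;\wedge^k\mathfrak g)=\ker\partial_{n-k-1}/\operatorname{im}\partial_{n-k}.$$ Then $$\dim_{\mathbb F_q}\mathcal D^k(V)=\sum_{1\le\alpha_1<\cdots<\alpha_{n-k}\le n-1}\ \prod_{j=1}^{n-k}\left(q^{\alpha_j}-1\right).$$ -/

import Mathlib

noncomputable section

open Module DirectSum
open scoped Classical

namespace Building

variable (F : Type*) [Field F] (V : Type*) [AddCommGroup V] [Module F V]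

/-- The vertices of the spherical building `X_V`: the linear subspaces `0 ≠ U ⊊ V`, ordered by
inclusion. -/
abbrev Vertex : Type _ := {U : Submodule F V // U ≠ ⊥ ∧ U ≠ ⊤}

/-- The simplices of `X_V` with `m` vertices (i.e. of dimension `m - 1`), written as strictly
increasing sequences `U₀ ⊊ ⋯ ⊊ U_{m-1}` of vertices. For `m = 0` this is the empty simplex. -/
abbrev Simplex (m : ℕ) : Type _ := Fin m ↪o Vertex F V

variable {F V}

/-- The face of `σ` obtained by deleting its `i`-th vertex (counted from `0`). -/
def Simplex.face {m : ℕ} (σ : Simplex F V (m + 1)) (i : Fin (m + 1)) : Simplex F V m :=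
  (Fin.succAboveOrderEmb i).trans σ

/-- The local system `𝔤` on objects: `𝔤(U₀ ⊊ ⋯ ⊊ U_{m-1}) = U₀` and `𝔤(∅) = V`. -/
def coeff : {m : ℕ} → Simplex F V m → Submodule F V
  | 0, _ => ⊤
  | _ + 1, σ => (σ 0).1

/-- Passing to a face can only enlarge the value of `𝔤`. -/
theorem coeff_le_face {m : ℕ} (σ : Simplex F V (m + 1)) (i : Fin (m + 1)) :
    coeff σ ≤ coeff (σ.face i) := by
  cases m with
  | zero => exact le_top
  | succ m => exact σ.monotone (Fin.zero_le _)

variable (F V)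

/-- The twisted chains `C_{m-1}(X_V; ⋀^k 𝔤)`: formal sums `∑ c(σ) σ` over the simplices `σ` with
`m` vertices, where `c(σ) ∈ ⋀^k 𝔤(σ)`. -/
def Chains (k m : ℕ) : Type _ := ⨁ σ : Simplex F V m, ⋀[F]^k (coeff σ)

instance (k m : ℕ) : AddCommGroup (Chains F V k m) :=
  inferInstanceAs (AddCommGroup (⨁ σ : Simplex F V m, ⋀[F]^k (coeff σ)))

instance (k m : ℕ) : Module F (Chains F V k m) :=
  inferInstanceAs (Module F (⨁ σ : Simplex F V m, ⋀[F]^k (coeff σ)))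

variable {F V} in
/-- The chain `c σ` supported on the simplex `σ`, as a linear function of `c ∈ ⋀^k 𝔤(σ)`. -/
def Chains.single (k : ℕ) {m : ℕ} (σ : Simplex F V m) : ⋀[F]^k (coeff σ) →ₗ[F] Chains F V k m :=
  DirectSum.lof F (Simplex F V m) (fun τ => ⋀[F]^k (coeff τ)) σ

/-- The boundary map `∂_m : C_m(X_V; ⋀^k 𝔤) → C_{m-1}(X_V; ⋀^k 𝔤)`, which sends `c σ` to
`∑ i, (-1)^i ρ(c) σ_i`, where `ρ` is induced by the inclusion `𝔤(σ) ⊆ 𝔤(σ_i)`. -/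
def boundary (k m : ℕ) : Chains F V k (m + 1) →ₗ[F] Chains F V k m :=
  DirectSum.toModule F _ _ fun σ =>
    ∑ i : Fin (m + 1), (-1 : F) ^ (i : ℕ) •
      (Chains.single k (σ.face i) ∘ₗ
        exteriorPower.map k (Submodule.inclusion (coeff_le_face σ i)))

theorem boundary_single (k m : ℕ) (σ : Simplex F V (m + 1)) (x : ⋀[F]^k (coeff σ)) :
    boundary F V k m (Chains.single k σ x) =
      ∑ i : Fin (m + 1), (-1 : F) ^ (i : ℕ) •
        Chains.single k (σ.face i)
          (exteriorPower.map k (Submodule.inclusion (coeff_le_face σ i)) x) := by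
  unfold boundary Chains.single
  erw [DirectSum.toModule_lof]
  simp only [LinearMap.sum_apply, LinearMap.smul_apply]
  rfl

/-- `∂ ∘ ∂ = 0`, so that the quotient below is the homology of a chain complex. -/
theorem boundary_boundary (k m : ℕ) :
    boundary F V k m ∘ₗ boundary F V k (m + 1) = 0 := by
  refine DirectSum.linearMap_ext F fun σ => LinearMap.ext fun x => ?_
  change boundary F V k m (boundary F V k (m + 1) (Chains.single k σ x)) = 0
  simp only [boundary_single, map_sum, map_smul, Finset.smul_sum, smul_smul]
  rw [← Finset.sum_product']
  refine Finset.sum_involution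
    (fun p _ => (p.1.succAbove p.2, p.2.predAbove p.1)) ?_ ?_ ?_ ?_
  · rintro ⟨i, j⟩ -
    have key : ∀ (τ τ' : Simplex F V m) (h : coeff σ ≤ coeff τ) (h' : coeff σ ≤ coeff τ'),
        τ = τ' → Chains.single k τ (exteriorPower.map k (Submodule.inclusion h) x) =
          Chains.single k τ' (exteriorPower.map k (Submodule.inclusion h') x) := by
      rintro τ _ h h' rfl; rfl
    have comp : ∀ (i : Fin (m + 2)) (j : Fin (m + 1)),
        exteriorPower.map k (Submodule.inclusion (coeff_le_face (σ.face i) j))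
          (exteriorPower.map k (Submodule.inclusion (coeff_le_face σ i)) x) =
        exteriorPower.map k (Submodule.inclusion
          ((coeff_le_face σ i).trans (coeff_le_face (σ.face i) j))) x := by
      intro i j
      rw [← LinearMap.comp_apply, ← exteriorPower.map_comp]
      rfl
    simp only [comp]
    rw [key ((σ.face (i.succAbove j)).face (j.predAbove i)) ((σ.face i).face j) _
      ((coeff_le_face σ i).trans (coeff_le_face (σ.face i) j)), ← add_smul]
    · convert zero_smul F _
      rcases Fin.lt_or_ge j.castSucc i with h | h
      · rw [Fin.succAbove_of_castSucc_lt _ _ h, Fin.predAbove_of_castSucc_lt _ _ h]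
        obtain ⟨i, rfl⟩ := Fin.exists_succ_eq.2 (Fin.ne_zero_of_lt h)
        simp [pow_succ, mul_comm]
      · rw [Fin.succAbove_of_le_castSucc _ _ h, Fin.predAbove_of_le_castSucc _ _ h]
        simp [pow_succ, mul_comm]
    · ext1 l
      exact congrArg σ (Fin.succAbove_succAbove_succAbove_predAbove i j l)
  · rintro ⟨i, j⟩ - - h
    exact Fin.succAbove_ne i j (congrArg Prod.fst h)
  · intro p _; simp
  · rintro ⟨i, j⟩ -
    simp [Fin.succAbove_succAbove_predAbove, Fin.predAbove_predAbove_succAbove]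

/-- The reduced homology `H̃_i(X_V; ⋀^k 𝔤) = ker ∂_i / im ∂_{i+1}` for `i ≥ 0`. The complex is
the augmented one: `∂_0` takes values in `C_{-1}(X_V; ⋀^k 𝔤) = ⋀^k V`. -/
abbrev ReducedHomology (k i : ℕ) : Type _ :=
  LinearMap.ker (boundary F V k i) ⧸
    (LinearMap.range (boundary F V k (i + 1))).submoduleOf (LinearMap.ker (boundary F V k i))

/-- `𝒟^k(V) = H̃_{n-k-1}(X_V; ⋀^k 𝔤)` with `n = dim V`, for `1 ≤ k ≤ n - 1`. -/
abbrev D (k : ℕ) : Type _ := ReducedHomology F V k (finrank F V - k - 1)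

end Building

end

/-! The twisted complex is exact below its top degree, so $\dim\mathcal D^k(V)$ is, up to sign, an
Euler characteristic, and this is a coefficient of the characteristic polynomial of the lattice of
subspaces.

In `Chains F V k m` the index `m` counts vertices. A simplex with `m` vertices has $\dim U_0\le
n-m$, so chains vanish for $m>n-k$ and $\mathcal D^k(V)$ is the kernel of the boundary at $m=n-k$.

Exactness for $m<n-k$ (`exactIn_bldCoeff`) is proved for every subspace $X$ by induction on $\dim
X$. Choose $e\in X$ and a linear form $\varphi$ with $\varphi(e)=1$, and put $H=X\cap\ker\varphi$. A
cycle is first moved off the hyperplanes of $X$ that miss $e$ and differ from $H$; chains below such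
a hyperplane form a complex of smaller dimension (`exists_bd_avoid_maximal`). Contraction with
$\varphi$ maps $\wedge^{k+1}U$ to $\wedge^k(U\cap H)$ with kernel $\wedge^{k+1}(U\cap H)$. The image
part is handled by the retraction $U\mapsto U+\langle e\rangle$ and the complex of $H$ in exterior
degree $k$ (`exactIn_of_line`); the kernel part is contracted by $U\mapsto U\cap H$
(`exactIn_inf_ker`).

For the Euler characteristic, $\sum_s(-1)^{|s|}T^{\dim U_0}$ over chains of proper subspaces equals
$\prod_{i<n}(T-q^i)$ (`chainPoly_eq_prod`). Replacing $T$ by $T+1$ and reading off the coefficient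
of $T^k$ turns $T^{\dim U_0}$ into $\binom{\dim U_0}{k}=\dim\wedge^kU_0$, and the product into an
elementary symmetric function of the $1-q^i$. -/

noncomputable section

open Module DirectSum
open scoped Classical

namespace Building

/-! ### Chains on finite subsets of a poset -/

section Poset

variable (F : Type*) [Field F] {P : Type*} [PartialOrder P] {M : Type*} [AddCommGroup M]
  [Module F M]

/-- The sign with which `x` is inserted into the finite set `s`. -/
def insSign (x : P) (s : Finset P) : F := (-1) ^ (s.filter (· < x)).card

theorem insSign_mul_self (x : P) (s : Finset P) : insSign F x s * insSign F x s = 1 := by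
  unfold insSign
  rw [← pow_add, ← two_mul, pow_mul]
  simp

variable [DecidableEq P]

theorem insSign_insert_of_not_lt {x y : P} (s : Finset P) (h : ¬ y < x) :
    insSign F x (insert y s) = insSign F x s := by
  unfold insSign
  rw [Finset.filter_insert, if_neg h]

theorem insSign_insert_of_lt {x y : P} {s : Finset P} (h : y < x) (hy : y ∉ s) :
    insSign F x (insert y s) = - insSign F x s := by
  unfold insSign
  rw [Finset.filter_insert, if_pos h, Finset.card_insert_of_notMem (by simp [hy]), pow_succ]
  simp

/-- Exactly one of the two comparable elements counts towards the sign of the other. For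
incomparable elements neither does, which is why `bd_bd` needs support on chains. -/
theorem insSign_swap {x y : P} {s : Finset P} (h : x ≤ y ∨ y ≤ x) (hxy : x ≠ y)
    (hx : x ∉ s) (hy : y ∉ s) :
    insSign F x (insert y s) * insSign F y s = - (insSign F y (insert x s) * insSign F x s) := by
  rcases h with h | h
  · have h' := lt_of_le_of_ne h hxy
    rw [insSign_insert_of_lt F h' hx, insSign_insert_of_not_lt F s h'.not_gt]
    ring
  · have h' := lt_of_le_of_ne h hxy.symm
    rw [insSign_insert_of_lt F h' hy, insSign_insert_of_not_lt F s h'.not_gt]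
    ring

variable [Fintype P]

/-- The simplicial boundary on functions on finite subsets of `P`. -/
def bd : (Finset P → M) →ₗ[F] (Finset P → M) where
  toFun c s := ∑ x ∈ sᶜ, insSign F x s • c (insert x s)
  map_add' c c' := by
    ext s
    simp [smul_add, Finset.sum_add_distrib]
  map_smul' a c := by
    ext s
    simp [Finset.smul_sum, smul_comm a]

theorem bd_apply (c : Finset P → M) (s : Finset P) :
    bd F c s = ∑ x ∈ sᶜ, insSign F x s • c (insert x s) := rfl

theorem bd_comp {M' : Type*} [AddCommGroup M'] [Module F M'] (f : M →ₗ[F] M')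
    (c : Finset P → M) : bd F (fun s => f (c s)) = fun s => f (bd F c s) := by
  ext s
  simp [bd_apply]

theorem bd_mem {N : Finset P → Submodule F M} (hN : ∀ x s, N (insert x s) ≤ N s)
    {c : Finset P → M} (hc : ∀ s, c s ∈ N s) (s : Finset P) : bd F c s ∈ N s :=
  Submodule.sum_mem _ fun x _ => Submodule.smul_mem _ _ (hN x s (hc _))

theorem bd_card {c : Finset P → M} {m : ℕ} (hc : ∀ s, c s ≠ 0 → s.card = m + 1)
    (s : Finset P) (hs : bd F c s ≠ 0) : s.card = m := by
  obtain ⟨x, hx, hx'⟩ := Finset.exists_ne_zero_of_sum_ne_zero hs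
  have := hc _ (right_ne_zero_of_smul hx')
  rw [Finset.card_insert_of_notMem (by simpa using hx)] at this
  omega

theorem bd_bd {c : Finset P → M}
    (hc : ∀ s, c s ≠ 0 → IsChain (· ≤ ·) (s : Set P)) : bd F (bd F c) = 0 := by
  ext s
  simp only [bd_apply, Finset.smul_sum, smul_smul, Pi.zero_apply]
  rw [Finset.sum_sigma']
  refine Finset.sum_involution (fun p _ => ⟨p.2, p.1⟩) ?_ ?_ ?_ ?_
  · rintro ⟨x, y⟩ h
    simp only [Finset.mem_sigma, Finset.mem_compl, Finset.mem_insert, not_or] at h ⊢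
    rw [Finset.insert_comm x y s, ← add_smul]
    by_cases h0 : c (insert y (insert x s)) = 0
    · simp [h0]
    have hxy : x ≤ y ∨ y ≤ x :=
      (hc _ h0).total (by simp) (by simp)
    have := insSign_swap F hxy (Ne.symm h.2.1) h.1 h.2.2
    rw [mul_comm (insSign F y s), this, mul_comm (insSign F x s)]
    simp
  · rintro ⟨x, y⟩ h _ h'
    simp only [Finset.mem_sigma, Finset.mem_compl, Finset.mem_insert, not_or] at h
    exact h.2.1 (congrArg Sigma.fst h')
  · rintro ⟨x, y⟩ h
    simp only [Finset.mem_sigma, Finset.mem_compl, Finset.mem_insert, not_or] at h ⊢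
    exact ⟨h.2.2, fun h' => h.2.1 h'.symm, h.1⟩
  · rintro ⟨x, y⟩ h
    rfl

/-- Inserting `g (s.filter p)` into `s` is a contracting homotopy for the part of the complex
where `s.filter p` has `t` elements, up to parts where it has fewer elements. -/
theorem exists_bd_lower_level {N : Finset P → Submodule F M} (p : P → Prop) (g : Finset P → P)
    (t : ℕ) (hg : ∀ s, ¬ p (g s))
    (hcomp : ∀ s, N s ≠ ⊥ → (s.filter p).card = t →
      ∀ x ∈ s, x ≤ g (s.filter p) ∨ g (s.filter p) ≤ x)
    (hN : ∀ s, (s.filter p).card = t → N s ≤ N (insert (g (s.filter p)) s))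
    {z : Finset P → M} (hz : ∀ s, z s ∈ N s) (hlev : ∀ s, z s ≠ 0 → (s.filter p).card ≤ t)
    {m : ℕ} (hm : ∀ s, z s ≠ 0 → s.card = m) (hd : bd F z = 0) :
    ∃ w : Finset P → M, (∀ s, w s ∈ N s) ∧ (∀ s, w s ≠ 0 → s.card = m + 1) ∧
      ∀ s, (z - bd F w) s ≠ 0 → (s.filter p).card < t := by
  have hfe : ∀ (s : Finset P) (x : P), ¬ p x → (s.erase x).filter p = s.filter p := by
    intro s x hx
    rw [Finset.filter_erase, Finset.erase_eq_of_notMem (by simp [hx])]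
  have hfi : ∀ (s : Finset P) (x : P), ¬ p x → (insert x s).filter p = s.filter p := by
    intro s x hx
    rw [Finset.filter_insert, if_neg hx]
  -- The cone operator: read `z` on the set with the cone vertex removed, and 0 off level `t` or
  -- when that vertex is absent.
  let w : Finset P → M := fun s =>
    if (s.filter p).card = t ∧ g (s.filter p) ∈ s then
      insSign F (g (s.filter p)) s • z (s.erase (g (s.filter p))) else 0
  have hw : ∀ s, w s = if (s.filter p).card = t ∧ g (s.filter p) ∈ s then
      insSign F (g (s.filter p)) s • z (s.erase (g (s.filter p))) else 0 := fun s => rfl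
  clear_value w
  refine ⟨w, fun s => ?_, fun s hs => ?_, fun s hs => ?_⟩
  · rw [hw]
    split_ifs with h
    · refine Submodule.smul_mem _ _ ?_
      have h1 := hN (s.erase (g (s.filter p))) (by rw [hfe _ _ (hg _)]; exact h.1)
      rw [hfe _ _ (hg _), Finset.insert_erase h.2] at h1
      exact h1 (hz _)
    · exact zero_mem _
  · rw [hw] at hs
    split_ifs at hs with h
    · have h1 := hm _ (right_ne_zero_of_smul hs)
      rw [Finset.card_erase_of_mem h.2] at h1
      have := Finset.card_pos.2 ⟨_, h.2⟩
      omega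
    · exact absurd rfl hs
  · by_contra hlt
    push Not at hlt
    apply hs
    rw [Pi.sub_apply, sub_eq_zero, bd_apply]
    -- A new vertex satisfying `p` pushes the level above `t`, where `w` is 0 by definition.
    have hp0 : ∀ x ∉ s, p x → w (insert x s) = 0 := by
      intro x hx hpx
      rw [hw, if_neg]
      rintro ⟨h, -⟩
      rw [Finset.filter_insert, if_pos hpx, Finset.card_insert_of_notMem (by simp [hx])] at h
      omega
    rcases hlt.lt_or_eq with hlt | heq
    · rw [Finset.sum_eq_zero]
      · by_contra h
        exact absurd (hlev s h) (by omega)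
      · intro x hx
        by_cases hpx : p x
        · rw [hp0 x (by simpa using hx) hpx, smul_zero]
        · rw [hw, if_neg, smul_zero]
          rw [hfi _ _ hpx]
          omega
    obtain ⟨G, hG⟩ : ∃ G, G = g (s.filter p) := ⟨_, rfl⟩
    have hpG : ¬ p G := hG ▸ hg _
    by_cases hGs : G ∈ s
    · obtain ⟨s', hGs', rfl⟩ : ∃ s', G ∉ s' ∧ s = insert G s' :=
        ⟨s.erase G, by simp, (Finset.insert_erase hGs).symm⟩
      have hf' : s'.filter p = (insert G s').filter p := (hfi _ _ hpG).symm
      -- If the cone vertex `G` lies in `s`, the cycle condition at `s \ {G}` expresses `z s`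
      -- through the other terms, and these are the terms of `bd F w` at `s`.
      have h0 : ∑ x ∈ s'ᶜ, insSign F x s' • z (insert x s') = 0 := congrFun hd s'
      have hGc : G ∈ s'ᶜ := by simpa using hGs'
      rw [← Finset.add_sum_erase _ _ hGc] at h0
      have hc : (insert G s')ᶜ = s'ᶜ.erase G := by
        ext; simp
      rw [hc]
      have h1 : ∀ x ∈ s'ᶜ.erase G, insSign F x (insert G s') • w (insert x (insert G s')) =
          - (insSign F G s' • insSign F x s' • z (insert x s')) := by
        intro x hx
        simp only [Finset.mem_erase, Finset.mem_compl] at hx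
        by_cases hpx : p x
        · rw [hp0 x (by simp [hx.1, hx.2]) hpx]
          have : z (insert x s') = 0 := by
            by_contra h
            have := hlev _ h
            rw [Finset.filter_insert, if_pos hpx, Finset.card_insert_of_notMem (by simp [hx.2]),
              hf'] at this
            omega
          simp [this]
        · have hfx : (insert x (insert G s')).filter p = (insert G s').filter p := hfi _ _ hpx
          rw [hw, if_pos (by rw [hfx, ← hG]; exact ⟨heq.symm, by simp⟩), hfx, ← hG,
            Finset.insert_comm x G, Finset.erase_insert (by simp [hGs', Ne.symm hx.1]),
            insSign_insert_of_not_lt F _ (lt_irrefl G)]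
          by_cases hzx : z (insert x s') = 0
          · simp [hzx]
          have hNx : N (insert x s') ≠ ⊥ := fun h => hzx (by simpa [h] using hz (insert x s'))
          have hfx' : (insert x s').filter p = (insert G s').filter p := by
            rw [hfi _ _ hpx, hf']
          have hcx := hcomp (insert x s') hNx (by rw [hfx', ← heq]) x (by simp)
          rw [hfx', ← hG] at hcx
          rw [smul_smul, smul_smul, ← neg_smul]
          congr 1
          have h2 := insSign_swap F hcx hx.1 hx.2 hGs'
          have h3 := insSign_mul_self F G s'
          calc _ = (insSign F x (insert G s') * insSign F G s') *
                (insSign F G s' * insSign F G (insert x s')) := by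
                  linear_combination (-(insSign F x (insert G s') * insSign F G (insert x s'))) * h3
            _ = - (insSign F G (insert x s') * insSign F G (insert x s')) *
                (insSign F G s' * insSign F x s') := by rw [h2]; ring
            _ = _ := by rw [insSign_mul_self]; ring
      rw [Finset.sum_congr rfl h1, Finset.sum_neg_distrib, ← Finset.smul_sum,
        ← neg_eq_iff_add_eq_zero.2 h0, smul_neg, neg_neg, smul_smul, insSign_mul_self, one_smul]
    -- If `G` is not in `s`, only inserting `G` itself gives a set on which `w` can be nonzero.
    · rw [Finset.sum_eq_single G]
      · rw [hw, hfi _ _ hpG, ← hG, if_pos ⟨heq.symm, by simp⟩, Finset.erase_insert hGs,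
          insSign_insert_of_not_lt F _ (lt_irrefl G), smul_smul, insSign_mul_self, one_smul]
      · intro x hx hxG
        by_cases hpx : p x
        · rw [hp0 x (by simpa using hx) hpx, smul_zero]
        · rw [hw, hfi _ _ hpx, if_neg, smul_zero]
          rintro ⟨-, h⟩
          rw [← hG, Finset.mem_insert] at h
          exact h.elim (fun h => hxG h.symm) hGs
      · intro h
        exact absurd hGs (by simpa using h)

/-- Strip off the levels one at a time from the top. The threshold `r` allows for cone vertices that
are only admissible when enough vertices satisfy `p`. -/
theorem exists_bd_level_lt {N : Finset P → Submodule F M} (p : P → Prop) (g : Finset P → P)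
    (r : ℕ) (hg : ∀ s, ¬ p (g s)) (hanti : ∀ x s, N (insert x s) ≤ N s)
    (hchain : ∀ s, N s ≠ ⊥ → IsChain (· ≤ ·) (s : Set P))
    (hcomp : ∀ s, N s ≠ ⊥ → r ≤ (s.filter p).card →
      ∀ x ∈ s, x ≤ g (s.filter p) ∨ g (s.filter p) ≤ x)
    (hN : ∀ s, r ≤ (s.filter p).card → N s ≤ N (insert (g (s.filter p)) s))
    {z : Finset P → M} (hz : ∀ s, z s ∈ N s)
    {m : ℕ} (hm : ∀ s, z s ≠ 0 → s.card = m) (hd : bd F z = 0) :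
    ∃ w : Finset P → M, (∀ s, w s ∈ N s) ∧ (∀ s, w s ≠ 0 → s.card = m + 1) ∧
      ∀ s, (z - bd F w) s ≠ 0 → (s.filter p).card < r := by
  suffices H : ∀ (j : ℕ) (z : Finset P → M), (∀ s, z s ∈ N s) → (∀ s, z s ≠ 0 → s.card = m) →
      bd F z = 0 → (∀ s, z s ≠ 0 → (s.filter p).card < r + j) →
      ∃ w : Finset P → M, (∀ s, w s ∈ N s) ∧ (∀ s, w s ≠ 0 → s.card = m + 1) ∧
        ∀ s, (z - bd F w) s ≠ 0 → (s.filter p).card < r by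
    refine H (Fintype.card P + 1) z hz hm hd fun s _ => ?_
    have := Finset.card_le_univ (s.filter p)
    omega
  intro j
  induction j with
  | zero =>
    intro z _ _ _ hlev
    exact ⟨0, fun s => zero_mem _, fun s h => absurd rfl h, fun s => by simpa using hlev s⟩
  | succ j ih =>
    intro z hz hm hd hlev
    obtain ⟨w, hw, hwm, hwl⟩ := exists_bd_lower_level F p g (r + j) hg
      (fun s h h' => hcomp s h (by omega)) (fun s h => hN s (by omega)) hz
      (fun s h => by have := hlev s h; omega) hm hd
    have hwc : ∀ s, w s ≠ 0 → IsChain (· ≤ ·) (s : Set P) := fun s hs =>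
      hchain s fun h => hs (by simpa [h] using hw s)
    obtain ⟨w', hw', hwm', hwl'⟩ := ih (z - bd F w)
      (fun s => Submodule.sub_mem _ (hz s) (bd_mem F hanti hw s))
      (fun s hs => by
        by_contra h
        refine hs ?_
        rw [Pi.sub_apply, not_not.1 (mt (hm s) h), not_not.1 (mt (bd_card F hwm s) h), sub_zero])
      (by rw [map_sub, hd, bd_bd F hwc, sub_zero]) hwl
    refine ⟨w + w', fun s => Submodule.add_mem _ (hw s) (hw' s), fun s hs => ?_, ?_⟩
    · by_contra h
      refine hs ?_
      rw [Pi.add_apply, not_not.1 (mt (hwm s) h), not_not.1 (mt (hwm' s) h), add_zero]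
    · rwa [map_add, ← sub_sub]

/-- Restriction of a chain along a map `f` defined on `A`. -/
def pull (A : P → Prop) (f : P → P) (c : Finset P → M) : Finset P → M := fun t =>
  if ∀ x ∈ t, A x then c (t.image f) else 0

/-- The signs depend only on the order among the vertices, so an order isomorphism between the `A`
and the `B` elements commutes with the boundary. The support condition ensures that each
contributing inserted vertex comes from `A`. -/
theorem bd_pull {A B : P → Prop} {f g : P → P} (hg : ∀ y, B y → A (g y))
    (hgf : ∀ x, A x → g (f x) = x) (hfg : ∀ y, B y → f (g y) = y)
    (hlt : ∀ x y, A x → A y → (f x < f y ↔ x < y)) {c : Finset P → M}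
    (hc : ∀ s, c s ≠ 0 → ∀ y ∈ s, B y) : bd F (pull A f c) = pull A f (bd F c) := by
  ext t
  have hinj : ∀ x y, A x → A y → f x = f y → x = y := fun x y hx hy h => by
    rw [← hgf x hx, h, hgf y hy]
  by_cases ht : ∀ x ∈ t, A x
  · rw [pull, if_pos ht, bd_apply, bd_apply]
    refine Finset.sum_bij_ne_zero (fun x _ _ => f x) ?_ ?_ ?_ ?_
    · intro x hx hne
      have hA : ∀ y ∈ insert x t, A y := by
        by_contra h
        rw [pull, if_neg h, smul_zero] at hne
        exact hne rfl
      simp only [Finset.mem_compl, Finset.mem_image, not_exists, not_and] at hx ⊢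
      intro y hy h
      exact hx (hinj y x (hA _ (by simp [hy])) (hA _ (by simp)) h ▸ hy)
    · intro x hx hxne y hy hyne h
      have hA : ∀ x, insSign F x t • pull A f c (insert x t) ≠ 0 → A x := by
        intro x hne
        by_contra h
        rw [pull, if_neg (fun h' => h (h' x (by simp))), smul_zero] at hne
        exact hne rfl
      exact hinj x y (hA x hxne) (hA y hyne) h
    · intro y hy hne
      have hB := hc _ (right_ne_zero_of_smul hne)
      have hAy : A (g y) := hg y (hB y (by simp))
      have hfy : f (g y) = y := hfg y (hB y (by simp))
      refine ⟨g y, ?_, ?_, hfy⟩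
      · simp only [Finset.mem_compl, Finset.mem_image, not_exists, not_and] at hy ⊢
        intro h
        exact hy _ h hfy
      · rw [pull, if_pos (by simpa using ⟨hAy, ht⟩), Finset.image_insert, hfy]
        refine smul_ne_zero ?_ (right_ne_zero_of_smul hne)
        exact left_ne_zero_of_mul (a := insSign F _ _) (b := insSign F (g y) t)
          (by rw [insSign_mul_self]; exact one_ne_zero)
    · intro x hx hne
      have hA : ∀ y ∈ insert x t, A y := by
        by_contra h
        rw [pull, if_neg h, smul_zero] at hne
        exact hne rfl
      rw [pull, if_pos hA, Finset.image_insert]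
      congr 1
      unfold insSign
      congr 1
      rw [Finset.filter_image, Finset.card_image_of_injOn]
      · congr 1
        ext y
        simp only [Finset.mem_filter, and_congr_right_iff]
        intro hy
        exact (hlt y x (ht y hy) (hA x (by simp))).symm
      · intro a ha b hb h
        simp only [Finset.coe_filter, Set.mem_ofPred_eq] at ha hb
        exact hinj a b (ht a ha.1) (ht b hb.1) h
  · rw [pull, if_neg ht, bd_apply]
    refine Finset.sum_eq_zero fun x _ => ?_
    rw [pull, if_neg, smul_zero]
    intro h
    exact ht fun y hy => h y (by simp [hy])

end Poset

/-! ### Exterior powers of subspaces inside the exterior algebra -/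

section Exterior

variable {F : Type*} [Field F] {V : Type*} [AddCommGroup V] [Module F V]

/-- The `k`-th exterior power of the subspace `U`, as a subspace of the exterior algebra of `V`. -/
def extPow (k : ℕ) (U : Submodule F V) : Submodule F (ExteriorAlgebra F V) :=
  (U.map (ExteriorAlgebra.ι F)) ^ k

theorem extPow_zero (U : Submodule F V) : extPow 0 U = 1 := pow_zero _

theorem extPow_succ (k : ℕ) (U : Submodule F V) :
    extPow (k + 1) U = U.map (ExteriorAlgebra.ι F) * extPow k U := pow_succ' _ _

theorem extPow_mono (k : ℕ) {U U' : Submodule F V} (h : U ≤ U') : extPow k U ≤ extPow k U' := by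
  induction k with
  | zero => rw [extPow_zero, extPow_zero]
  | succ k ih =>
    rw [extPow_succ, extPow_succ]
    exact mul_le_mul' (Submodule.map_mono h) ih

theorem extPow_succ_bot (k : ℕ) : extPow (k + 1) (⊥ : Submodule F V) = ⊥ := by
  rw [extPow_succ, Submodule.map_bot, Submodule.bot_mul]

theorem ι_mul_mem_extPow {k : ℕ} {U : Submodule F V} {u : V} (hu : u ∈ U)
    {x : ExteriorAlgebra F V} (hx : x ∈ extPow k U) :
    ExteriorAlgebra.ι F u * x ∈ extPow (k + 1) U := by
  rw [extPow_succ]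
  exact Submodule.mul_mem_mul (Submodule.mem_map_of_mem hu) hx

/-- Expand each factor along $W+\langle e\rangle$, move $e$ to the front by anticommutation, and use
$e\wedge e=0$. -/
theorem exists_eq_add_ι_mul {k : ℕ} {U W : Submodule F V} {e : V} (hU : U ≤ W ⊔ F ∙ e)
    {x : ExteriorAlgebra F V} (hx : x ∈ extPow (k + 1) U) :
    ∃ y ∈ extPow (k + 1) W, ∃ x' ∈ extPow k W, x = y + ExteriorAlgebra.ι F e * x' := by
  induction k generalizing x with
  | zero =>
    rw [extPow, pow_one] at hx
    obtain ⟨u, hu, rfl⟩ := hx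
    obtain ⟨w, hw, v, hv, rfl⟩ := Submodule.mem_sup.1 (hU hu)
    obtain ⟨a, rfl⟩ := Submodule.mem_span_singleton.1 hv
    refine ⟨ExteriorAlgebra.ι F w, ?_, algebraMap F _ a, ?_, ?_⟩
    · rw [extPow, pow_one]
      exact Submodule.mem_map_of_mem hw
    · rw [extPow_zero]
      exact Submodule.algebraMap_mem a
    · rw [map_add, map_smul, ← Algebra.commutes, ← Algebra.smul_def]
  | succ k ih =>
    rw [extPow_succ] at hx
    induction hx using Submodule.mul_induction_on' with
    | mem_mul_mem a ha b hb =>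
      obtain ⟨u, hu, rfl⟩ := ha
      obtain ⟨w, hw, v, hv, rfl⟩ := Submodule.mem_sup.1 (hU hu)
      obtain ⟨a, rfl⟩ := Submodule.mem_span_singleton.1 hv
      obtain ⟨y, hy, x', hx', rfl⟩ := ih hb
      refine ⟨ExteriorAlgebra.ι F w * y, ι_mul_mem_extPow hw hy,
        a • y - ExteriorAlgebra.ι F w * x', Submodule.sub_mem _ (Submodule.smul_mem _ _ hy)
          (ι_mul_mem_extPow hw hx'), ?_⟩
      have h1 : ExteriorAlgebra.ι F e * ExteriorAlgebra.ι F e = 0 := ExteriorAlgebra.ι_sq_zero e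
      have h2 : ExteriorAlgebra.ι F w * ExteriorAlgebra.ι F e =
          - (ExteriorAlgebra.ι F e * ExteriorAlgebra.ι F w) :=
        eq_neg_of_add_eq_zero_left (ExteriorAlgebra.ι_add_mul_swap w e)
      rw [map_add, map_smul, add_mul, mul_add, mul_add, ← mul_assoc, h2, mul_sub, smul_mul_assoc,
        smul_mul_assoc, mul_smul_comm, ← mul_assoc (ExteriorAlgebra.ι F e) (ExteriorAlgebra.ι F e),
        h1, neg_mul, mul_assoc]
      simp
      abel
    | add a _ b _ iha ihb =>
      obtain ⟨y, hy, x', hx', rfl⟩ := iha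
      obtain ⟨y₂, hy₂, x₂, hx₂, rfl⟩ := ihb
      exact ⟨y + y₂, add_mem hy hy₂, x' + x₂, add_mem hx' hx₂, by rw [mul_add]; abel⟩

/-- Contraction of the exterior algebra by a linear form. -/
def contract (φ : Dual F V) : ExteriorAlgebra F V →ₗ[F] ExteriorAlgebra F V :=
  CliffordAlgebra.contractLeft φ

theorem contract_ι_mul (φ : Dual F V) (v : V) (x : ExteriorAlgebra F V) :
    contract φ (ExteriorAlgebra.ι F v * x) =
      φ v • x - ExteriorAlgebra.ι F v * contract φ x :=
  CliffordAlgebra.contractLeft_ι_mul φ v x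

theorem contract_eq_zero {φ : Dual F V} {k : ℕ} {U : Submodule F V} (hU : U ≤ LinearMap.ker φ)
    {x : ExteriorAlgebra F V} (hx : x ∈ extPow k U) : contract φ x = 0 := by
  induction k generalizing x with
  | zero =>
    rw [extPow_zero] at hx
    obtain ⟨a, rfl⟩ := Submodule.mem_one.1 hx
    exact CliffordAlgebra.contractLeft_algebraMap _ φ a
  | succ k ih =>
    rw [extPow_succ] at hx
    induction hx using Submodule.mul_induction_on' with
    | mem_mul_mem a ha b hb =>
      obtain ⟨u, hu, rfl⟩ := ha
      rw [contract_ι_mul, ih hb, LinearMap.mem_ker.1 (hU hu)]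
      simp
    | add a _ b _ iha ihb => rw [map_add, iha, ihb, add_zero]

theorem exists_mem_apply_eq_one {φ : Dual F V} {U : Submodule F V}
    (hU : ¬ U ≤ LinearMap.ker φ) : ∃ u ∈ U, φ u = 1 := by
  obtain ⟨u, hu, h⟩ := SetLike.not_le_iff_exists.1 hU
  rw [LinearMap.mem_ker] at h
  exact ⟨(φ u)⁻¹ • u, U.smul_mem _ hu, by simp [h]⟩

theorem le_inf_ker_sup_span {φ : Dual F V} {U : Submodule F V} {u : V} (hu : u ∈ U)
    (h : φ u = 1) : U ≤ U ⊓ LinearMap.ker φ ⊔ F ∙ u := by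
  intro v hv
  refine Submodule.mem_sup.2 ⟨v - φ v • u, ⟨U.sub_mem hv (U.smul_mem _ hu), ?_⟩, φ v • u,
    Submodule.smul_mem _ _ (Submodule.mem_span_singleton_self u), by abel⟩
  simp [h]

/-- With $\varphi(u)=1$ and $x=y+u\wedge x'$, where $y,x'$ are built from $U\cap\ker\varphi$,
contraction returns $x'$. The next two lemmas read kernel and image off the same splitting. -/
theorem contract_mem {φ : Dual F V} {k : ℕ} {U : Submodule F V} {x : ExteriorAlgebra F V}
    (hx : x ∈ extPow (k + 1) U) : contract φ x ∈ extPow k (U ⊓ LinearMap.ker φ) := by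
  by_cases hU : U ≤ LinearMap.ker φ
  · rw [contract_eq_zero hU hx]
    exact zero_mem _
  obtain ⟨u, hu, h⟩ := exists_mem_apply_eq_one hU
  obtain ⟨y, hy, x', hx', rfl⟩ := exists_eq_add_ι_mul (le_inf_ker_sup_span hu h) hx
  rwa [map_add, contract_eq_zero inf_le_right hy, contract_ι_mul, contract_eq_zero inf_le_right hx',
    h, one_smul, mul_zero, sub_zero, zero_add]

theorem mem_of_contract_eq_zero {φ : Dual F V} {k : ℕ} {U : Submodule F V}
    {x : ExteriorAlgebra F V} (hx : x ∈ extPow (k + 1) U) (h0 : contract φ x = 0) :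
    x ∈ extPow (k + 1) (U ⊓ LinearMap.ker φ) := by
  by_cases hU : U ≤ LinearMap.ker φ
  · rwa [inf_eq_left.2 hU]
  obtain ⟨u, hu, h⟩ := exists_mem_apply_eq_one hU
  obtain ⟨y, hy, x', hx', rfl⟩ := exists_eq_add_ι_mul (le_inf_ker_sup_span hu h) hx
  rw [map_add, contract_eq_zero inf_le_right hy, contract_ι_mul, contract_eq_zero inf_le_right hx',
    h, one_smul, mul_zero, sub_zero, zero_add] at h0
  rwa [h0, mul_zero, add_zero]

theorem exists_contract_eq {φ : Dual F V} {k : ℕ} {U : Submodule F V}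
    (hU : ¬ U ≤ LinearMap.ker φ) {y : ExteriorAlgebra F V}
    (hy : y ∈ extPow k (U ⊓ LinearMap.ker φ)) : ∃ x ∈ extPow (k + 1) U, contract φ x = y := by
  obtain ⟨u, hu, h⟩ := exists_mem_apply_eq_one hU
  refine ⟨ExteriorAlgebra.ι F u * y, ι_mul_mem_extPow hu (extPow_mono k inf_le_left hy), ?_⟩
  rw [contract_ι_mul, contract_eq_zero inf_le_right hy, h]
  simp

end Exterior

/-! ### Exactness of the twisted complex below the top degree -/

section Exactness

variable {F : Type*} [Field F] {V : Type*} [AddCommGroup V] [Module F V]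
  {M : Type*} [AddCommGroup M] [Module F M]

/-- The coefficients on finite sets `s` of subspaces: `L (⋂ s)` if `s` is a chain of subspaces
satisfying `A`, and `0` otherwise. -/
def chainCoeff (A : Submodule F V → Prop) (L : Submodule F V → Submodule F M)
    (s : Finset (Submodule F V)) : Submodule F M :=
  if IsChain (· ≤ ·) (s : Set (Submodule F V)) ∧ ∀ U ∈ s, A U then L (s.inf id) else ⊥

theorem chainCoeff_of {A : Submodule F V → Prop} (L : Submodule F V → Submodule F M)
    {s : Finset (Submodule F V)} (h : IsChain (· ≤ ·) (s : Set (Submodule F V)))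
    (h' : ∀ U ∈ s, A U) : chainCoeff A L s = L (s.inf id) := if_pos ⟨h, h'⟩

theorem chainCoeff_ne_bot {A : Submodule F V → Prop} {L : Submodule F V → Submodule F M}
    {s : Finset (Submodule F V)} (h : chainCoeff A L s ≠ ⊥) :
    IsChain (· ≤ ·) (s : Set (Submodule F V)) ∧ ∀ U ∈ s, A U := by
  by_contra h'
  exact h (if_neg h')

theorem chainCoeff_le {A : Submodule F V → Prop} {L : Submodule F V → Submodule F M}
    {s : Finset (Submodule F V)} {N : Submodule F M}
    (h : IsChain (· ≤ ·) (s : Set (Submodule F V)) → (∀ U ∈ s, A U) → L (s.inf id) ≤ N) :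
    chainCoeff A L s ≤ N := by
  unfold chainCoeff
  split_ifs with h'
  · exact h h'.1 h'.2
  · exact bot_le

theorem chainCoeff_supp {A : Submodule F V → Prop} {L : Submodule F V → Submodule F M}
    {s : Finset (Submodule F V)} {x : M} (h : x ∈ chainCoeff A L s) (hx : x ≠ 0) :
    IsChain (· ≤ ·) (s : Set (Submodule F V)) ∧ ∀ U ∈ s, A U :=
  chainCoeff_ne_bot fun h' => hx (by rwa [h', Submodule.mem_bot] at h)

theorem chainCoeff_insert_le {A : Submodule F V → Prop} {L : Submodule F V → Submodule F M}
    (hL : Monotone L) (U : Submodule F V) (s : Finset (Submodule F V)) :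
    chainCoeff A L (insert U s) ≤ chainCoeff A L s := by
  refine chainCoeff_le fun h h' => ?_
  rw [chainCoeff_of L (h.mono (by simp)) fun U hU => h' U (by simp [hU])]
  exact hL (Finset.inf_mono (by simp))

theorem sup_mem_of_isChain {s : Finset (Submodule F V)} (hs : s.Nonempty)
    (h : IsChain (· ≤ ·) (s : Set (Submodule F V))) : s.sup id ∈ s := by
  obtain ⟨a, ha⟩ := s.exists_maximal hs
  have : s.sup id = a := le_antisymm
    (Finset.sup_le fun b hb => (h.total hb ha.1).elim id fun h => ha.2 hb h)
    (Finset.le_sup (f := id) ha.1)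
  exact this ▸ ha.1

theorem inf_mem_of_isChain {s : Finset (Submodule F V)} (hs : s.Nonempty)
    (h : IsChain (· ≤ ·) (s : Set (Submodule F V))) : s.inf id ∈ s := by
  obtain ⟨a, ha⟩ := s.exists_minimal hs
  have : s.inf id = a := le_antisymm (Finset.inf_le (f := id) ha.1)
    (Finset.le_inf fun b hb => (h.total ha.1 hb).elim id fun h => ha.2 hb h)
  exact this ▸ ha.1

/-- The coefficients of the twisted complex of the building of `X`. -/
def bldCoeff (X : Submodule F V) (k : ℕ) :
    Finset (Submodule F V) → Submodule F (ExteriorAlgebra F V) :=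
  chainCoeff (· < X) fun U => extPow k (X ⊓ U)

theorem bldCoeff_mono (X : Submodule F V) (k : ℕ) :
    Monotone fun U : Submodule F V => extPow k (X ⊓ U) :=
  fun _ _ h => extPow_mono k (inf_le_inf_left X h)

variable [Fintype (Submodule F V)]

/-- Exactness, at the sets with `m` elements, of the complex with coefficients in `N`. -/
def ExactIn (N : Finset (Submodule F V) → Submodule F M) (m : ℕ) : Prop :=
  ∀ z : Finset (Submodule F V) → M, (∀ s, z s ∈ N s) → (∀ s, z s ≠ 0 → s.card = m) →
    bd F z = 0 → ∃ w : Finset (Submodule F V) → M, (∀ s, w s ∈ N s) ∧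
      (∀ s, w s ≠ 0 → s.card = m + 1) ∧ bd F w = z

/-- The coefficients see only $U\cap H$ with $H=X\cap\ker\varphi$, so the retraction $U\mapsto U\cap
H$ costs nothing. Inserting $H\cap\bigcap T$, where $T$ is the set of vertices outside
$\ker\varphi$, keeps the set a chain and the coefficient unchanged. For empty $T$ the cone vertex is
$H$, so every level is removed. -/
theorem exactIn_inf_ker {X : Submodule F V} {φ : Dual F V} (hX : ¬ X ≤ LinearMap.ker φ)
    (k m : ℕ) :
    ExactIn (chainCoeff (· < X) fun U => extPow k (X ⊓ LinearMap.ker φ ⊓ U)) m := by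
  intro z hz hm hd
  have hmono : Monotone fun U : Submodule F V => extPow k (X ⊓ LinearMap.ker φ ⊓ U) :=
    fun _ _ h => extPow_mono k (inf_le_inf_left _ h)
  obtain ⟨p, hp⟩ : ∃ p : Submodule F V → Prop, ∀ U, p U ↔ ¬ U ≤ LinearMap.ker φ :=
    ⟨_, fun _ => Iff.rfl⟩
  have hcomp : ∀ s : Finset (Submodule F V), IsChain (· ≤ ·) (s : Set (Submodule F V)) →
      (∀ U ∈ s, U < X) → ∀ x ∈ s,
      x ≤ X ⊓ LinearMap.ker φ ⊓ (s.filter p).inf id ∨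
      X ⊓ LinearMap.ker φ ⊓ (s.filter p).inf id ≤ x := by
    intro s h h' x hx
    by_cases hxφ : x ≤ LinearMap.ker φ
    · refine Or.inl (le_inf (le_inf (h' x hx).le hxφ) (Finset.le_inf fun y hy => ?_))
      rw [Finset.mem_filter, hp] at hy
      exact (h.total hx hy.1).resolve_right fun h => hy.2 (h.trans hxφ)
    · exact Or.inr (inf_le_right.trans (Finset.inf_le (f := id) (by simp [hx, hp, hxφ])))
  obtain ⟨w, hw, hwm, hwl⟩ := exists_bd_level_lt F p
    (fun T => X ⊓ LinearMap.ker φ ⊓ T.inf id) 0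
    (fun T => (hp _).not.2 <| not_not.2 (inf_le_left.trans inf_le_right)) (chainCoeff_insert_le hmono)
    (fun s hs => (chainCoeff_ne_bot hs).1)
    (fun s hs _ => hcomp s (chainCoeff_ne_bot hs).1 (chainCoeff_ne_bot hs).2)
    (fun s _ => by
      refine chainCoeff_le fun h h' => ?_
      rw [chainCoeff_of]
      · rw [Finset.inf_insert]
        refine extPow_mono k (le_inf inf_le_left (le_inf (inf_le_inf_left _ ?_) inf_le_right))
        exact Finset.inf_mono (by simp)
      · rw [Finset.coe_insert]
        exact h.insert fun x hx _ => (hcomp s h h' x hx).symm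
      · intro U hU
        rcases Finset.mem_insert.1 hU with rfl | hU
        · exact lt_of_le_of_lt inf_le_left (inf_lt_left.2 hX)
        · exact h' U hU) hz hm hd
  refine ⟨w, hw, hwm, ?_⟩
  ext1 s
  by_contra h
  exact absurd (hwl s (sub_ne_zero.2 (Ne.symm h))) (Nat.not_lt_zero _)

/-- A maximal proper subspace $U$ can only be the top of a chain, so the part of the cycle through
$U$ is a cycle for $U$ in one degree lower. Filling it there and adjoining $U$ again gives the
correction. -/
theorem exists_bd_avoid_maximal {X : Submodule F V} {k m : ℕ} {A : Submodule F V → Prop}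
    (hA : ∀ U, A U → U < X ∧ ∀ W, U < W → ¬ W < X)
    (hex : ∀ U, A U → ∀ m', m' + 1 = m → ExactIn (bldCoeff U k) m')
    {z : Finset (Submodule F V) → ExteriorAlgebra F V} (hz : ∀ s, z s ∈ bldCoeff X k s)
    (hm : ∀ s, z s ≠ 0 → s.card = m) (hd : bd F z = 0) :
    ∃ w : Finset (Submodule F V) → ExteriorAlgebra F V, (∀ s, w s ∈ bldCoeff X k s) ∧
      (∀ s, w s ≠ 0 → s.card = m + 1) ∧ ∀ s, (z - bd F w) s ≠ 0 → ∀ U ∈ s, ¬ A U := by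
  obtain _ | m := m
  · refine ⟨0, fun s => zero_mem _, fun s h => absurd rfl h, fun s h U hU => ?_⟩
    rw [map_zero, sub_zero] at h
    rw [Finset.card_eq_zero.1 (hm s h)] at hU
    simp at hU
  have key : ∀ U, ∃ w : Finset (Submodule F V) → ExteriorAlgebra F V, A U →
      (∀ s, w s ∈ bldCoeff U k s) ∧ (∀ s, w s ≠ 0 → s.card = m + 1) ∧
      bd F w = fun s => if U ∈ s then 0 else z (insert U s) := by
    intro U
    by_cases hU : A U
    swap
    · exact ⟨0, fun h => absurd h hU⟩
    have hlt : ∀ s x, z (insert U s) ≠ 0 → x ∈ s → x ≠ U → x < U := by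
      intro s x h hx hxU
      have h1 := chainCoeff_supp (hz _) h
      have h2 := h1.2 x (by simp [hx])
      rcases h1.1.total (show x ∈ _ by simp [hx]) (show U ∈ _ by simp) with h3 | h3
      · exact lt_of_le_of_ne h3 hxU
      · exact absurd h2 ((hA U hU).2 x (lt_of_le_of_ne h3 hxU.symm))
    refine (hex U hU m rfl (fun s => if U ∈ s then 0 else z (insert U s)) ?_ ?_ ?_).imp
      fun w h _ => h
    · intro s
      split_ifs with hUs
      · exact zero_mem _
      by_cases h0 : z (insert U s) = 0
      · rw [h0]
        exact zero_mem _
      have h1 := chainCoeff_supp (hz _) h0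
      have h2 := hz (insert U s)
      rw [bldCoeff, chainCoeff_of _ h1.1 h1.2, Finset.inf_insert] at h2
      rw [bldCoeff, chainCoeff_of _ (h1.1.mono (by simp))
        (fun x hx => hlt s x h0 hx fun h => hUs (h ▸ hx))]
      exact extPow_mono k inf_le_right h2
    · intro s hs
      split_ifs at hs with hUs
      · exact absurd rfl hs
      · have := hm _ hs
        rw [Finset.card_insert_of_notMem hUs] at this
        omega
    · ext1 s
      rw [bd_apply, Pi.zero_apply]
      by_cases hUs : U ∈ s
      · exact Finset.sum_eq_zero fun x _ => by simp [hUs]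
      have h0 : ∑ x ∈ (insert U s)ᶜ, insSign F x (insert U s) • z (insert x (insert U s)) = 0 :=
        congrFun hd (insert U s)
      have hUc : U ∈ sᶜ := by simpa using hUs
      rw [← Finset.add_sum_erase _ _ hUc]
      have hc : (insert U s)ᶜ = sᶜ.erase U := by ext; simp
      rw [hc] at h0
      simp only [Finset.mem_insert, true_or, if_true, smul_zero, zero_add]
      rw [← h0]
      refine Finset.sum_congr rfl fun x hx => ?_
      simp only [Finset.mem_erase, Finset.mem_compl] at hx
      rw [if_neg (by simp [hUs, Ne.symm hx.1]), Finset.insert_comm U x]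
      by_cases hz0 : z (insert x (insert U s)) = 0
      · simp [hz0]
      rw [Finset.insert_comm] at hz0
      rw [insSign_insert_of_not_lt F s (hlt (insert x s) x hz0 (by simp) hx.1).not_gt]
  choose W hW using key
  -- Sum of the fillings with their tops restored. Adjoining a top changes no sign, as signs count
  -- smaller vertices.
  refine ⟨fun s => ∑ U ∈ s.filter A, W U (s.erase U), fun s => ?_, fun s hs => ?_,
    fun s hs U hUs hU => ?_⟩
  · refine Submodule.sum_mem _ fun U hU => ?_
    rw [Finset.mem_filter] at hU
    by_cases h0 : W U (s.erase U) = 0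
    · rw [h0]
      exact zero_mem _
    have h1 := chainCoeff_supp ((hW U hU.2).1 _) h0
    have h2 := (hW U hU.2).1 (s.erase U)
    rw [bldCoeff, chainCoeff_of _ h1.1 h1.2] at h2
    have h3 : U ⊓ (s.erase U).inf id = s.inf id := by
      conv_rhs => rw [← Finset.insert_erase hU.1, Finset.inf_insert, id]
    rw [bldCoeff, chainCoeff_of]
    · rw [h3] at h2
      refine extPow_mono k (le_inf ?_ le_rfl) h2
      exact (Finset.inf_le (f := id) hU.1).trans (hA U hU.2).1.le
    · rw [← Finset.insert_erase hU.1, Finset.coe_insert]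
      exact h1.1.insert fun x hx _ => Or.inr (h1.2 x hx).le
    · intro x hx
      by_cases hxU : x = U
      · rw [hxU]
        exact (hA U hU.2).1
      · exact (h1.2 x (Finset.mem_erase.2 ⟨hxU, hx⟩)).trans (hA U hU.2).1
  · obtain ⟨U, hU, h0⟩ := Finset.exists_ne_zero_of_sum_ne_zero hs
    rw [Finset.mem_filter] at hU
    have := (hW U hU.2).2.1 _ h0
    rw [Finset.card_erase_of_mem hU.1] at this
    omega
  · refine hs ?_
    rw [Pi.sub_apply, sub_eq_zero, bd_apply]
    obtain ⟨s', hUs', rfl⟩ : ∃ s', U ∉ s' ∧ s = insert U s' :=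
      ⟨s.erase U, by simp, (Finset.insert_erase hUs).symm⟩
    have h0 := congrFun (hW U hU).2.2 s'
    simp only [if_neg hUs'] at h0
    rw [bd_apply] at h0
    have hUc : U ∈ s'ᶜ := by simpa using hUs'
    have hWU : ∀ t, ∀ x ∈ t, ¬ x < U → W U t = 0 := by
      intro t x hx h
      by_contra hne
      exact h ((chainCoeff_supp ((hW U hU).1 t) hne).2 x hx)
    rw [← h0, ← Finset.add_sum_erase _ _ hUc, hWU _ U (by simp) (lt_irrefl U), smul_zero, zero_add]
    have hc : (insert U s')ᶜ = s'ᶜ.erase U := by ext; simp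
    rw [hc]
    refine Finset.sum_congr rfl fun x hx => ?_
    simp only [Finset.mem_erase, Finset.mem_compl] at hx
    rw [Finset.sum_eq_single U]
    · rw [Finset.insert_comm, Finset.erase_insert (by simp [hUs', Ne.symm hx.1])]
      by_cases hUx : U < x
      · rw [hWU _ x (by simp) hUx.not_gt, smul_zero, smul_zero]
      · rw [insSign_insert_of_not_lt F s' hUx]
    -- Two different vertices satisfying `A` cannot lie in one chain, so the fillings do not
    -- interfere.
    · intro U' hU' hne
      rw [Finset.mem_filter] at hU'
      by_contra h
      have h1 := (chainCoeff_supp ((hW U' hU'.2).1 _) h).2 U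
        (Finset.mem_erase.2 ⟨hne.symm, by simp⟩)
      exact (hA U hU).2 U' h1 (hA U' hU'.2).1
    · intro h
      exact absurd (Finset.mem_filter.2 ⟨by simp, hU⟩) h

end Exactness

/-! ### Retraction along a line, and exactness by induction on dimension. -/

section Exactness

variable {F : Type*} [Field F] {V : Type*} [AddCommGroup V] [Module F V]

theorem sup_span_inf_ker {φ : Dual F V} {e : V} (he : φ e = 1) {U : Submodule F V}
    (hU : U ≤ LinearMap.ker φ) : (U ⊔ F ∙ e) ⊓ LinearMap.ker φ = U := by
  rw [sup_inf_assoc_of_le _ hU]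
  refine sup_eq_left.2 fun v hv => ?_
  obtain ⟨a, rfl⟩ := Submodule.mem_span_singleton.1 hv.1
  have : a = 0 := by simpa [he] using hv.2
  simp [this]

theorem inf_ker_sup_span {φ : Dual F V} {e : V} (he : φ e = 1) {U : Submodule F V}
    (hU : e ∈ U) : U ⊓ LinearMap.ker φ ⊔ F ∙ e = U :=
  le_antisymm (sup_le inf_le_left (by simpa using hU)) (le_inf_ker_sup_span hU he)

variable [Fintype (Submodule F V)]

/-- The retraction $U\mapsto U+\langle e\rangle$ pushes a cycle onto chains of subspaces containing
$e$. These correspond to the proper subspaces of $H=X\cap\ker\varphi$ by $U\mapsto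
U\cap\ker\varphi$, with inverse $U\mapsto U+\langle e\rangle$, so exactness for $H$ finishes. -/
theorem exactIn_of_line {X : Submodule F V} {φ : Dual F V} {e : V} (he : φ e = 1) (heX : e ∈ X)
    {k m : ℕ} (hex : ExactIn (bldCoeff (X ⊓ LinearMap.ker φ) k) m) :
    ExactIn (chainCoeff (fun U => U ⊔ F ∙ e < X ∧ ¬ U ≤ LinearMap.ker φ)
      fun U => extPow k (X ⊓ LinearMap.ker φ ⊓ U)) m := by
  intro z hz hm hd
  have hmono : Monotone fun U : Submodule F V => extPow k (X ⊓ LinearMap.ker φ ⊓ U) :=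
    fun _ _ h => extPow_mono k (inf_le_inf_left _ h)
  have hnk : ∀ U : Submodule F V, e ∈ U → ¬ U ≤ LinearMap.ker φ := by
    intro U hU h
    have := LinearMap.mem_ker.1 (h hU)
    rw [he] at this
    exact one_ne_zero this
  obtain ⟨p, hp⟩ : ∃ p : Submodule F V → Prop, ∀ U, p U ↔ e ∉ U := ⟨_, fun _ => Iff.rfl⟩
  have hcomp : ∀ s : Finset (Submodule F V), IsChain (· ≤ ·) (s : Set (Submodule F V)) →
      ∀ x ∈ s, x ≤ (s.filter p).sup id ⊔ F ∙ e ∨ (s.filter p).sup id ⊔ F ∙ e ≤ x := by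
    intro s h x hx
    by_cases hex : e ∈ x
    · refine Or.inr (sup_le (Finset.sup_le fun y hy => ?_) (by simpa using hex))
      rw [Finset.mem_filter, hp] at hy
      exact (h.total hx hy.1).resolve_left fun h => hy.2 (h hex)
    · exact Or.inl (le_sup_of_le_left (Finset.le_sup (f := id) (by simp [hx, hp, hex])))
  -- The threshold is 1: if every vertex contains `e`, the cone vertex would be the line $\langle
  -- e\rangle$ itself, which meets $\ker\varphi$ in 0 and would destroy the coefficient.
  obtain ⟨w₁, hw₁, hwm₁, hwl⟩ := exists_bd_level_lt F p (fun T => T.sup id ⊔ F ∙ e) 1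
    (fun T => (hp _).not.2 <| not_not.2 <|
      (le_sup_right : F ∙ e ≤ T.sup id ⊔ F ∙ e) (Submodule.mem_span_singleton_self e))
    (chainCoeff_insert_le hmono)
    (fun s hs => (chainCoeff_ne_bot hs).1)
    (fun s hs _ => hcomp s (chainCoeff_ne_bot hs).1)
    (fun s hs => by
      refine chainCoeff_le fun h h' => ?_
      have hT : (s.filter p).sup id ∈ s.filter p :=
        sup_mem_of_isChain (Finset.card_pos.1 hs) (h.mono (by exact_mod_cast Finset.filter_subset _ _))
      have hTs := (Finset.mem_filter.1 hT).1
      rw [chainCoeff_of]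
      · rw [Finset.inf_insert]
        refine extPow_mono k (le_inf inf_le_left (le_inf ?_ inf_le_right))
        exact inf_le_right.trans ((Finset.inf_le (f := id) hTs).trans le_sup_left)
      · rw [Finset.coe_insert]
        exact h.insert fun x hx _ => (hcomp s h x hx).symm
      · intro U hU
        rcases Finset.mem_insert.1 hU with rfl | hU
        · refine ⟨?_, hnk _ (Submodule.mem_sup_right (Submodule.mem_span_singleton_self e))⟩
          rw [sup_assoc, sup_idem]
          exact (h' _ hTs).1
        · exact h' U hU) hz hm hd
  set b := z - bd F w₁ with hb
  have hbN : ∀ s, b s ∈ _ := fun s =>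
    Submodule.sub_mem _ (hz s) (bd_mem F (chainCoeff_insert_le hmono) hw₁ s)
  have hbm : ∀ s, b s ≠ 0 → s.card = m := fun s hs => by
    by_contra h
    refine hs ?_
    rw [hb, Pi.sub_apply, not_not.1 (mt (hm s) h), not_not.1 (mt (bd_card F hwm₁ s) h), sub_zero]
  have hbd : bd F b = 0 := by
    rw [hb, map_sub, hd, bd_bd F, sub_zero]
    exact fun s hs => (chainCoeff_supp (hw₁ s) hs).1
  have hbB : ∀ s, b s ≠ 0 → ∀ y ∈ s, e ∈ y ∧ y < X := by
    intro s hs y hy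
    have hey : e ∈ y := by
      by_contra h
      have h1 := hwl s hs
      rw [Nat.lt_one_iff, Finset.card_eq_zero] at h1
      have : y ∈ s.filter p := by simp [hy, hp, h]
      rw [h1] at this
      simp at this
    refine ⟨hey, ?_⟩
    have := ((chainCoeff_supp (hbN s) hs).2 y hy).1
    rwa [sup_eq_left.2 (by simpa using hey)] at this
  set H := X ⊓ LinearMap.ker φ with hH
  have hle : ∀ x, x < H → x ≤ LinearMap.ker φ := fun x hx => hx.le.trans inf_le_right
  have hgf : ∀ x, x < H → (x ⊔ F ∙ e) ⊓ LinearMap.ker φ = x := fun x hx =>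
    sup_span_inf_ker he (hle x hx)
  have hfg : ∀ y, e ∈ y ∧ y < X → y ⊓ LinearMap.ker φ ⊔ F ∙ e = y := fun y hy =>
    inf_ker_sup_span he hy.1
  have hf : ∀ x, x < H → e ∈ x ⊔ F ∙ e ∧ x ⊔ F ∙ e < X := by
    intro x hx
    refine ⟨Submodule.mem_sup_right (Submodule.mem_span_singleton_self e), ?_⟩
    refine lt_of_le_of_ne (sup_le (hx.le.trans inf_le_left) (by simpa using heX)) fun h => ?_
    rw [← hgf x hx, h] at hx
    exact lt_irrefl _ hx
  have hg : ∀ y, e ∈ y ∧ y < X → y ⊓ LinearMap.ker φ < H := by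
    intro y hy
    refine lt_of_le_of_ne (inf_le_inf_right _ hy.2.le) fun h => hy.2.ne ?_
    rw [← hfg y hy, h, hH, inf_ker_sup_span he heX]
  have hlef : ∀ x y, x < H → y < H → (x ⊔ F ∙ e ≤ y ⊔ F ∙ e ↔ x ≤ y) := by
    intro x y hx hy
    refine ⟨fun h => ?_, fun h => sup_le_sup_right h _⟩
    rw [← hgf x hx, ← hgf y hy]
    exact inf_le_inf_right _ h
  have hleg : ∀ x y, e ∈ x ∧ x < X → e ∈ y ∧ y < X →
      (x ⊓ LinearMap.ker φ ≤ y ⊓ LinearMap.ker φ ↔ x ≤ y) := by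
    intro x y hx hy
    refine ⟨fun h => ?_, fun h => inf_le_inf_right _ h⟩
    rw [← hfg x hx, ← hfg y hy]
    exact sup_le_sup_right h _
  set c := pull (· < H) (· ⊔ F ∙ e) b with hc
  have hcs : ∀ t, c t ≠ 0 → (∀ x ∈ t, x < H) ∧ b (t.image (· ⊔ F ∙ e)) ≠ 0 := by
    intro t ht
    rw [hc, pull] at ht
    split_ifs at ht with h
    · exact ⟨h, ht⟩
    · exact absurd rfl ht
  obtain ⟨w, hw, hwm, hwd⟩ := hex c
    (by
      intro t
      by_cases h0 : c t = 0
      · rw [h0]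
        exact zero_mem _
      obtain ⟨h1, h2⟩ := hcs t h0
      have h3 := chainCoeff_supp (hbN _) h2
      have h4 := hbN (t.image (· ⊔ F ∙ e))
      rw [chainCoeff_of _ h3.1 h3.2] at h4
      rw [bldCoeff, chainCoeff_of _ _ h1, hc, pull, if_pos h1]
      · refine extPow_mono k (le_inf inf_le_left (Finset.le_inf fun x hx => ?_)) h4
        rw [← hgf x (h1 x hx)]
        refine le_inf (inf_le_right.trans (Finset.inf_le (f := id) ?_))
          (inf_le_left.trans inf_le_right)
        exact Finset.mem_image_of_mem _ hx
      · intro x hx y hy _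
        have := h3.1.total (Finset.mem_image_of_mem (· ⊔ F ∙ e) hx)
          (Finset.mem_image_of_mem (· ⊔ F ∙ e) hy)
        simpa only [hlef x y (h1 x hx) (h1 y hy), hlef y x (h1 y hy) (h1 x hx)] using this)
    (by
      intro t ht
      obtain ⟨h1, h2⟩ := hcs t ht
      rw [← hbm _ h2, Finset.card_image_of_injOn]
      intro x hx y hy h
      simp only at h
      rw [← hgf x (h1 x hx), h, hgf y (h1 y hy)])
    (by
      rw [hc, bd_pull F (B := fun y => e ∈ y ∧ y < X) hg hgf hfg
        (fun x y hx hy => by rw [lt_iff_le_not_ge, hlef x y hx hy, hlef y x hy hx, ← lt_iff_le_not_ge])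
        hbB, hbd]
      ext1 t
      simp [pull])
  set w₂ := pull (fun y => e ∈ y ∧ y < X) (· ⊓ LinearMap.ker φ) w with hw₂
  have hws : ∀ t, w₂ t ≠ 0 → (∀ x ∈ t, e ∈ x ∧ x < X) ∧
      w (t.image (· ⊓ LinearMap.ker φ)) ≠ 0 := by
    intro t ht
    rw [hw₂, pull] at ht
    split_ifs at ht with h
    · exact ⟨h, ht⟩
    · exact absurd rfl ht
  have hw₂d : bd F w₂ = b := by
    rw [hw₂, bd_pull F (B := fun x => x < H) hf hfg hgf
      (fun x y hx hy => by
        rw [lt_iff_le_not_ge, hleg x y hx hy, hleg y x hy hx, ← lt_iff_le_not_ge])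
      (fun t ht => (chainCoeff_supp (hw t) ht).2), hwd]
    ext1 s
    rw [pull]
    split_ifs with h
    · rw [hc, pull, if_pos, Finset.image_image]
      · congr 1
        conv_rhs => rw [← Finset.image_id (s := s)]
        exact Finset.image_congr fun y hy => hfg y (h y hy)
      · intro x hx
        obtain ⟨y, hy, rfl⟩ := Finset.mem_image.1 hx
        exact hg y (h y hy)
    · by_contra h0
      exact h (hbB s (Ne.symm h0))
  refine ⟨w₁ + w₂, fun s => Submodule.add_mem _ (hw₁ s) ?_, fun s hs => ?_, ?_⟩
  · by_cases h0 : w₂ s = 0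
    · rw [h0]
      exact zero_mem _
    obtain ⟨h1, h2⟩ := hws s h0
    have h3 := chainCoeff_supp (hw _) h2
    have h4 := hw (s.image (· ⊓ LinearMap.ker φ))
    rw [bldCoeff, chainCoeff_of _ h3.1 h3.2] at h4
    rw [chainCoeff_of, hw₂, pull, if_pos h1]
    · refine extPow_mono k (le_inf inf_le_left (Finset.le_inf fun x hx => ?_)) h4
      exact inf_le_right.trans
        ((Finset.inf_le (f := id) (Finset.mem_image_of_mem _ hx)).trans inf_le_left)
    · intro x hx y hy _
      have := h3.1.total (Finset.mem_image_of_mem (· ⊓ LinearMap.ker φ) hx)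
        (Finset.mem_image_of_mem (· ⊓ LinearMap.ker φ) hy)
      simpa only [hleg x y (h1 x hx) (h1 y hy), hleg y x (h1 y hy) (h1 x hx)] using this
    · intro x hx
      refine ⟨?_, hnk x (h1 x hx).1⟩
      rw [sup_eq_left.2 (by simpa using (h1 x hx).1)]
      exact (h1 x hx).2
  · by_contra h
    refine hs ?_
    have h2 : w₂ s = 0 := by
      by_contra h0
      obtain ⟨h1, h2⟩ := hws s h0
      refine h ?_
      rw [← hwm _ h2, Finset.card_image_of_injOn]
      intro x hx y hy h
      simp only at h
      rw [← hfg x (h1 x hx), h, hfg y (h1 y hy)]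
    rw [Pi.add_apply, not_not.1 (mt (hwm₁ s) h), h2, add_zero]
  · rw [map_add, hw₂d, hb]
    abel

/-- Both recursive calls preserve the bound $m+k<n$: a hyperplane lowers $n$ and $m$ by one,
contraction lowers $n$ and $k$ by one. -/
theorem exactIn_bldCoeff [FiniteDimensional F V] (n : ℕ) :
    ∀ (X : Submodule F V) (k m : ℕ), finrank F X = n → m + k < n → ExactIn (bldCoeff X k) m := by
  induction n using Nat.strong_induction_on with
  | _ n ih =>
  intro X k m hX hmk z hz hm hd
  have hX0 : X ≠ ⊥ := by
    rintro rfl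
    rw [finrank_bot] at hX
    omega
  obtain ⟨e, heX, he0⟩ := Submodule.exists_mem_ne_zero_of_ne_bot hX0
  obtain ⟨φ, he⟩ : ∃ φ : Dual F V, φ e = 1 := Module.Projective.exists_dual_eq_one F he0
  have hXk : ¬ X ≤ LinearMap.ker φ := fun h => by
    have := LinearMap.mem_ker.1 (h heX)
    rw [he] at this
    exact one_ne_zero this
  obtain _ | k := k
  -- In exterior degree 0 the coefficients are the scalars for every subspace, so $U$ may be
  -- replaced by $U\cap H$.
  · have h0 : bldCoeff X 0 =
        chainCoeff (· < X) fun U => extPow 0 (X ⊓ LinearMap.ker φ ⊓ U) := by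
      unfold bldCoeff
      simp only [extPow_zero]
    rw [h0] at hz ⊢
    exact exactIn_inf_ker hXk 0 m z hz hm hd
  have hrank : ∀ U : Submodule F V, U ⊔ F ∙ e = X → n ≤ finrank F U + 1 := by
    intro U hU
    have h1 := Submodule.finrank_add_le_finrank_add_finrank U (F ∙ e)
    rw [hU, hX, finrank_span_singleton he0] at h1
    exact h1
  have hlt : ∀ U : Submodule F V, U < X → finrank F U < n := fun U hU =>
    hX ▸ Submodule.finrank_lt_finrank_of_lt hU
  -- A proper $U$ with $U+\langle e\rangle=X$ is a hyperplane, hence maximal. These must be removed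
  -- because the retraction $U\mapsto U+\langle e\rangle$ would leave the proper subspaces; chains
  -- inside $\ker\varphi$ are killed by contraction, so $H$ may stay.
  obtain ⟨w₁, hw₁, hwm₁, hwA⟩ := exists_bd_avoid_maximal (X := X)
    (A := fun U => U < X ∧ U ⊔ F ∙ e = X ∧ U ≠ X ⊓ LinearMap.ker φ)
    (fun U hU => ⟨hU.1, fun W hUW hWX => by
      have h1 := hrank U hU.2.1
      have h2 := Submodule.finrank_lt_finrank_of_lt hUW
      have h3 := hlt W hWX
      omega⟩)
    (fun U hU m' hm' => by
      have h1 := hrank U hU.2.1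
      exact ih (finrank F U) (hlt U hU.1) U (k + 1) m' rfl (by omega)) hz hm hd
  have hmonoX := bldCoeff_mono X (k + 1)
  set z₁ := z - bd F w₁ with hz₁
  have hz₁N : ∀ s, z₁ s ∈ bldCoeff X (k + 1) s := fun s =>
    Submodule.sub_mem _ (hz s) (bd_mem F (chainCoeff_insert_le hmonoX) hw₁ s)
  have hz₁m : ∀ s, z₁ s ≠ 0 → s.card = m := fun s hs => by
    by_contra h
    refine hs ?_
    rw [hz₁, Pi.sub_apply, not_not.1 (mt (hm s) h), not_not.1 (mt (bd_card F hwm₁ s) h), sub_zero]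
  have hz₁d : bd F z₁ = 0 := by
    rw [hz₁, map_sub, hd, bd_bd F, sub_zero]
    exact fun s hs => (chainCoeff_supp (hw₁ s) hs).1
  have hexH : ExactIn (bldCoeff (X ⊓ LinearMap.ker φ) k) m := by
    have h1 := hrank _ (inf_ker_sup_span he heX)
    exact ih _ (hlt _ (inf_lt_left.2 hXk)) _ k m rfl (by omega)
  obtain ⟨b, hbN, hbm, hbd⟩ := exactIn_of_line he heX hexH (fun s => contract φ (z₁ s))
    (by
      intro s
      by_cases h0 : contract φ (z₁ s) = 0
      · rw [h0]
        exact zero_mem _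
      have h1 : z₁ s ≠ 0 := fun h => h0 (by rw [h, map_zero])
      have h2 := chainCoeff_supp (hz₁N s) h1
      have h3 := hz₁N s
      rw [bldCoeff, chainCoeff_of _ h2.1 h2.2] at h3
      have hnk : ∀ U ∈ s, ¬ U ≤ LinearMap.ker φ := fun U hU h =>
        h0 (contract_eq_zero (inf_le_right.trans ((Finset.inf_le (f := id) hU).trans h)) h3)
      rw [chainCoeff_of _ h2.1]
      · have := contract_mem (φ := φ) h3
        rwa [inf_right_comm] at this
      · intro U hU
        refine ⟨lt_of_le_of_ne (sup_le (h2.2 U hU).le (by simpa using heX)) fun h => ?_,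
          hnk U hU⟩
        refine hwA s h1 U hU ⟨h2.2 U hU, h, ?_⟩
        rintro rfl
        exact hnk _ hU inf_le_right)
    (fun s hs => hz₁m s fun h => hs (by rw [h, map_zero]))
    (by
      rw [bd_comp, hz₁d]
      ext1 s
      simp)
  have hlift : ∀ s, ∃ x ∈ bldCoeff X (k + 1) s, contract φ x = b s ∧ (b s = 0 → x = 0) := by
    intro s
    by_cases h0 : b s = 0
    · exact ⟨0, zero_mem _, by rw [h0, map_zero], fun _ => rfl⟩
    have h1 := chainCoeff_supp (hbN s) h0
    have h2 := hbN s
    rw [chainCoeff_of _ h1.1 h1.2, inf_right_comm] at h2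
    -- The bottom of the chain is not in $\ker\varphi$, which is what makes contraction onto there.
    have h3 : ¬ X ⊓ s.inf id ≤ LinearMap.ker φ := by
      rcases s.eq_empty_or_nonempty with rfl | hs
      · simpa using hXk
      · have h4 := h1.2 _ (inf_mem_of_isChain hs h1.1)
        rw [inf_eq_right.2 (le_sup_left.trans h4.1.le)]
        exact h4.2
    obtain ⟨x, hx, hxb⟩ := exists_contract_eq h3 h2
    refine ⟨x, ?_, hxb, fun h => absurd h h0⟩
    rw [bldCoeff, chainCoeff_of _ h1.1 fun U hU => lt_of_le_of_lt le_sup_left (h1.2 U hU).1]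
    exact hx
  choose w₂ hw₂ hw₂b hw₂0 using hlift
  have hw₂m : ∀ s, w₂ s ≠ 0 → s.card = m + 1 := fun s hs => hbm s fun h => hs (hw₂0 s h)
  -- After subtracting the lifted filling, contraction vanishes, so the remaining values lie in
  -- $\wedge^{k+1}(U\cap H)$.
  obtain ⟨w₃, hw₃, hwm₃, hwd₃⟩ := exactIn_inf_ker hXk (k + 1) m (z₁ - bd F w₂)
    (by
      intro s
      have h1 : (z₁ - bd F w₂) s ∈ bldCoeff X (k + 1) s :=
        Submodule.sub_mem _ (hz₁N s) (bd_mem F (chainCoeff_insert_le hmonoX) hw₂ s)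
      by_cases h0 : (z₁ - bd F w₂) s = 0
      · rw [h0]
        exact zero_mem _
      have h2 := chainCoeff_supp h1 h0
      rw [bldCoeff, chainCoeff_of _ h2.1 h2.2] at h1
      rw [chainCoeff_of _ h2.1 h2.2, inf_right_comm]
      refine mem_of_contract_eq_zero h1 ?_
      have h3 := congrFun (bd_comp F (contract φ) w₂) s
      simp only [hw₂b] at h3
      rw [Pi.sub_apply, map_sub, ← h3]
      exact sub_eq_zero.2 (congrFun hbd s).symm)
    (fun s hs => by
      by_contra h
      refine hs ?_
      rw [Pi.sub_apply, not_not.1 (mt (hz₁m s) h), not_not.1 (mt (bd_card F hw₂m s) h), sub_zero])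
    (by
      rw [map_sub, hz₁d, bd_bd F, sub_zero]
      exact fun s hs => (chainCoeff_supp (hw₂ s) hs).1)
  refine ⟨w₁ + w₂ + w₃, fun s => ?_, fun s hs => ?_, ?_⟩
  · refine Submodule.add_mem _ (Submodule.add_mem _ (hw₁ s) (hw₂ s)) ?_
    refine (chainCoeff_le fun h h' => ?_ :
      chainCoeff (· < X) (fun U => extPow (k + 1) (X ⊓ LinearMap.ker φ ⊓ U)) s ≤ _) (hw₃ s)
    rw [bldCoeff, chainCoeff_of _ h h']
    exact extPow_mono _ (inf_le_inf_right _ inf_le_left)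
  · by_contra h
    refine hs ?_
    rw [Pi.add_apply, Pi.add_apply, not_not.1 (mt (hwm₁ s) h), not_not.1 (mt (hw₂m s) h),
      not_not.1 (mt (hwm₃ s) h), add_zero, add_zero]
  · rw [map_add, map_add, hwd₃, hz₁]
    abel

end Exactness

/-! ### Comparison with the complex of the building -/

section Comparison

variable {F : Type*} [Field F] {V : Type*} [AddCommGroup V] [Module F V]

/-- The inclusion of `⋀^k U` into the exterior algebra of `V`. -/
def toExt (k : ℕ) (U : Submodule F V) : ⋀[F]^k U →ₗ[F] ExteriorAlgebra F V :=
  (ExteriorAlgebra.map U.subtype).toLinearMap ∘ₗ Submodule.subtype _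

theorem toExt_injective (k : ℕ) (U : Submodule F V) : Function.Injective (toExt k U) :=
  (ExteriorAlgebra.map_injective_field (by simp)).comp Subtype.val_injective

theorem range_toExt (k : ℕ) (U : Submodule F V) : LinearMap.range (toExt k U) = extPow k U := by
  rw [toExt, LinearMap.range_comp, Submodule.range_subtype, extPow]
  erw [Submodule.map_pow, ExteriorAlgebra.ι_range_map_map, Submodule.range_subtype]

/-- Inside the exterior algebra of $V$ all the connecting maps $\rho_i$ become inclusions, so the
twisted boundary becomes `bd`. -/
theorem toExt_inclusion (k : ℕ) {U U' : Submodule F V} (h : U ≤ U') (x : ⋀[F]^k U) :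
    toExt k U' (exteriorPower.map k (Submodule.inclusion h) x) = toExt k U x := by
  suffices H : toExt k U' ∘ₗ exteriorPower.map k (Submodule.inclusion h) = toExt k U from
    LinearMap.congr_fun H x
  refine exteriorPower.linearMap_ext ?_
  ext v
  simp only [LinearMap.compAlternatingMap_apply, LinearMap.comp_apply, toExt,
    exteriorPower.map_apply_ιMulti, Submodule.subtype_apply, exteriorPower.ιMulti_apply_coe,
    AlgHom.toLinearMap_apply, ExteriorAlgebra.map_apply_ιMulti]
  rfl

/-- The set of vertices of a simplex. -/
def Simplex.verts {m : ℕ} (σ : Simplex F V m) : Finset (Submodule F V) :=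
  Finset.univ.image fun i => (σ i).1

theorem Simplex.val_injective {m : ℕ} (σ : Simplex F V m) :
    Function.Injective fun i => (σ i).1 :=
  Subtype.val_injective.comp σ.injective

theorem Simplex.card_verts {m : ℕ} (σ : Simplex F V m) : σ.verts.card = m := by
  rw [verts, Finset.card_image_of_injective _ σ.val_injective, Finset.card_fin]

theorem Simplex.isChain_verts {m : ℕ} (σ : Simplex F V m) :
    IsChain (· ≤ ·) (σ.verts : Set (Submodule F V)) := by
  intro x hx y hy _
  obtain ⟨i, -, rfl⟩ := Finset.mem_image.1 hx
  obtain ⟨j, -, rfl⟩ := Finset.mem_image.1 hy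
  exact (le_total i j).imp (fun h => σ.monotone h) fun h => σ.monotone h

theorem Simplex.verts_injective (m : ℕ) :
    Function.Injective (Simplex.verts : Simplex F V m → Finset (Submodule F V)) := by
  intro σ τ h
  refine DFunLike.coe_injective ((StrictMono.range_inj σ.strictMono τ.strictMono).1 ?_)
  ext x
  have := congrArg (x.1 ∈ ·) h
  simpa [verts, Subtype.ext_iff] using this

theorem Simplex.exists_verts_eq {s : Finset (Submodule F V)}
    (h : IsChain (· ≤ ·) (s : Set (Submodule F V))) (h' : ∀ U ∈ s, U ≠ ⊥ ∧ U ≠ ⊤) :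
    ∃ σ : Simplex F V s.card, σ.verts = s := by
  let _ : LinearOrder (s : Set (Submodule F V)) := h.linearOrder
  let f := Fintype.orderIsoFinOfCardEq (s : Set (Submodule F V)) (k := s.card) (by simp)
  refine ⟨OrderEmbedding.ofMapLEIff (fun i => ⟨(f i).1, h' _ (f i).2⟩)
    fun i j => f.le_iff_le, ?_⟩
  ext U
  simp only [verts, Finset.mem_image, Finset.mem_univ, true_and]
  exact ⟨fun ⟨i, hi⟩ => hi ▸ (f i).2,
    fun hU => ⟨f.symm ⟨U, hU⟩, congrArg Subtype.val (f.apply_symm_apply _)⟩⟩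

theorem Simplex.inf_verts {m : ℕ} (σ : Simplex F V m) : σ.verts.inf id = coeff σ := by
  cases m with
  | zero => simp [verts, coeff]
  | succ m =>
    refine le_antisymm (Finset.inf_le (f := id) (Finset.mem_image_of_mem _ (Finset.mem_univ 0)))
      (Finset.le_inf fun x hx => ?_)
    obtain ⟨i, -, rfl⟩ := Finset.mem_image.1 hx
    exact σ.monotone (Fin.zero_le i)

theorem Simplex.verts_face {m : ℕ} (σ : Simplex F V (m + 1)) (i : Fin (m + 1)) :
    (σ.face i).verts = σ.verts.erase (σ i).1 := by
  ext U
  simp only [verts, face, Finset.mem_image, Finset.mem_univ, true_and, Finset.mem_erase]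
  constructor
  · rintro ⟨j, rfl⟩
    exact ⟨fun h => Fin.succAbove_ne i j (σ.val_injective h), _, rfl⟩
  · rintro ⟨h, j, rfl⟩
    obtain ⟨l, rfl⟩ := Fin.exists_succAbove_eq (x := j) (y := i) (fun h' => h (by rw [h']))
    exact ⟨l, rfl⟩

theorem Simplex.insSign_verts {m : ℕ} (σ : Simplex F V m) (i : Fin m) :
    insSign F (σ i).1 σ.verts = (-1) ^ (i : ℕ) := by
  unfold insSign
  congr 1
  rw [verts, Finset.filter_image, Finset.card_image_of_injective _ σ.val_injective,
    ← Fin.card_Iio i]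
  congr 1
  ext j
  simp only [Finset.mem_filter, Finset.mem_univ, true_and, Finset.mem_Iio]
  exact σ.lt_iff_lt

variable (F V) in
/-- Twisted chains as functions on finite sets of subspaces. -/
def toFun (k m : ℕ) : Chains F V k m →ₗ[F] (Finset (Submodule F V) → ExteriorAlgebra F V) :=
  DirectSum.toModule F _ _ fun σ => LinearMap.single F _ σ.verts ∘ₗ toExt k (coeff σ)

theorem toFun_single (k : ℕ) {m : ℕ} (σ : Simplex F V m) (x : ⋀[F]^k (coeff σ)) :
    toFun F V k m (Chains.single k σ x) = Pi.single σ.verts (toExt k (coeff σ) x) := by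
  unfold toFun Chains.single
  erw [DirectSum.toModule_lof]
  rfl

theorem chains_induction {k m : ℕ} {p : Chains F V k m → Prop} (h0 : p 0)
    (hs : ∀ σ x, p (Chains.single k σ x)) (ha : ∀ x y, p x → p y → p (x + y))
    (c : Chains F V k m) : p c :=
  DirectSum.induction_on c h0 hs ha

/-- The coefficient of a twisted chain at the simplex `σ`. -/
def Chains.coord (k : ℕ) {m : ℕ} (σ : Simplex F V m) : Chains F V k m →ₗ[F] ⋀[F]^k (coeff σ) :=
  DirectSum.component F (Simplex F V m) (fun τ => ⋀[F]^k (coeff τ)) σ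

theorem Chains.coord_single (k : ℕ) {m : ℕ} (σ : Simplex F V m) (x : ⋀[F]^k (coeff σ)) :
    Chains.coord k σ (Chains.single k σ x) = x :=
  DFinsupp.single_eq_same

theorem Chains.coord_single_of_ne (k : ℕ) {m : ℕ} {σ τ : Simplex F V m} (h : τ ≠ σ)
    (x : ⋀[F]^k (coeff τ)) : Chains.coord k σ (Chains.single k τ x) = 0 :=
  DFinsupp.single_eq_of_ne h.symm

theorem toFun_apply_verts (k m : ℕ) (c : Chains F V k m) (σ : Simplex F V m) :
    toFun F V k m c σ.verts = toExt k (coeff σ) (Chains.coord k σ c) := by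
  induction c using chains_induction with
  | h0 => simp only [map_zero, Pi.zero_apply]
  | hs τ x =>
    rw [toFun_single]
    by_cases h : τ = σ
    · subst h
      rw [Chains.coord_single, Pi.single_eq_same]
    · rw [Pi.single_eq_of_ne (fun h' => h (Simplex.verts_injective m h'.symm)),
        Chains.coord_single_of_ne k h, map_zero]
  | ha x y hx hy => simp only [map_add, Pi.add_apply, hx, hy]

theorem toFun_injective (k m : ℕ) : Function.Injective (toFun F V k m) := by
  rw [← LinearMap.ker_eq_bot, LinearMap.ker_eq_bot']
  intro c hc
  refine DFinsupp.ext fun σ => ?_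
  have h := toFun_apply_verts k m c σ
  rw [hc, Pi.zero_apply, ← map_zero (toExt k (coeff σ))] at h
  exact (toExt_injective k _ h).symm

theorem toFun_mem (k m : ℕ) (c : Chains F V k m) (s : Finset (Submodule F V)) :
    toFun F V k m c s ∈ bldCoeff ⊤ k s := by
  induction c using chains_induction with
  | h0 => rw [map_zero]; exact zero_mem _
  | hs τ x =>
    rw [toFun_single]
    by_cases h : s = τ.verts
    · subst h
      rw [Pi.single_eq_same, bldCoeff, chainCoeff_of _ τ.isChain_verts, top_inf_eq,
        Simplex.inf_verts, ← range_toExt]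
      · exact LinearMap.mem_range_self _ _
      · intro U hU
        obtain ⟨i, -, rfl⟩ := Finset.mem_image.1 hU
        exact lt_top_iff_ne_top.2 (τ i).2.2
    · rw [Pi.single_eq_of_ne h]
      exact zero_mem _
  | ha x y hx hy => rw [map_add]; exact Submodule.add_mem _ hx hy

theorem toFun_card (k m : ℕ) (c : Chains F V k m) (s : Finset (Submodule F V))
    (h : toFun F V k m c s ≠ 0) : s.card = m := by
  induction c using chains_induction with
  | h0 => rw [map_zero] at h; exact absurd rfl h
  | hs τ x =>
    rw [toFun_single] at h
    by_cases h' : s = τ.verts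
    · rw [h', Simplex.card_verts]
    · exact absurd (Pi.single_eq_of_ne h' _) h
  | ha x y hx hy =>
    rw [map_add] at h
    by_contra h'
    exact h (by rw [Pi.add_apply, not_not.1 (mt hx h'), not_not.1 (mt hy h'), add_zero])

/-- `bldCoeff` admits the zero subspace as a vertex while the building does not; $k\ge1$ makes this
harmless, since $\wedge^k0=0$. -/
theorem exists_toFun_eq [Finite (Submodule F V)] {k m : ℕ} (hk : 1 ≤ k)
    {w : Finset (Submodule F V) → ExteriorAlgebra F V} (hw : ∀ s, w s ∈ bldCoeff ⊤ k s)
    (hm : ∀ s, w s ≠ 0 → s.card = m) : ∃ c, toFun F V k m c = w := by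
  have : Finite (Simplex F V m) := DFunLike.finite _
  let _ := Fintype.ofFinite (Simplex F V m)
  have hpre : ∀ σ : Simplex F V m, ∃ x, toExt k (coeff σ) x = w σ.verts := by
    intro σ
    rw [← LinearMap.mem_range, range_toExt, ← σ.inf_verts]
    have h : bldCoeff ⊤ k σ.verts ≤ extPow k (σ.verts.inf id) :=
      chainCoeff_le fun _ _ => by rw [top_inf_eq]
    exact h (hw _)
  choose x hx using hpre
  refine ⟨∑ σ, Chains.single k σ (x σ), ?_⟩
  ext1 s
  rw [map_sum, Finset.sum_apply]
  simp only [toFun_single, hx]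
  by_cases hs : ∃ σ : Simplex F V m, σ.verts = s
  · obtain ⟨σ, rfl⟩ := hs
    rw [Finset.sum_eq_single σ, Pi.single_eq_same]
    · exact fun τ _ h => Pi.single_eq_of_ne (fun h' => h (Simplex.verts_injective m h'.symm)) _
    · exact fun h => absurd (Finset.mem_univ σ) h
  · rw [Finset.sum_eq_zero fun τ _ => Pi.single_eq_of_ne (fun h => hs ⟨τ, h.symm⟩) _]
    by_contra h0
    have h1 := chainCoeff_supp (hw s) (Ne.symm h0)
    obtain rfl := hm s (Ne.symm h0)
    refine hs (Simplex.exists_verts_eq h1.1 fun U hU => ⟨?_, (h1.2 U hU).ne⟩)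
    rintro rfl
    have h2 := hw s
    obtain ⟨k, rfl⟩ := Nat.exists_eq_add_of_le' hk
    rw [bldCoeff, chainCoeff_of _ h1.1 h1.2, top_inf_eq,
      le_bot_iff.1 (Finset.inf_le (f := id) hU), extPow_succ_bot, Submodule.mem_bot] at h2
    exact h0 h2.symm

variable [Fintype (Submodule F V)]

theorem bd_single {M : Type*} [AddCommGroup M] [Module F M] (S : Finset (Submodule F V)) (y : M) :
    bd F (Pi.single S y) = ∑ x ∈ S, insSign F x S • Pi.single (S.erase x) y := by
  ext1 t
  rw [bd_apply, Finset.sum_apply]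
  refine Finset.sum_bij_ne_zero (fun x _ _ => x) ?_ (fun _ _ _ _ _ _ h => h) ?_ ?_
  · intro x hx hne
    have : insert x t = S := by
      by_contra h
      exact right_ne_zero_of_smul hne (Pi.single_eq_of_ne h _)
    rw [← this]
    simp
  · intro x hx hne
    have : t = S.erase x := by
      by_contra h
      rw [Pi.smul_apply, Pi.single_eq_of_ne h, smul_zero] at hne
      exact hne rfl
    subst this
    refine ⟨x, by simp, ?_, rfl⟩
    rw [Finset.insert_erase hx, Pi.single_eq_same]
    rw [Pi.smul_apply, Pi.single_eq_same] at hne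
    refine smul_ne_zero (fun h => ?_) (right_ne_zero_of_smul hne)
    have := insSign_mul_self F x (S.erase x)
    rw [h, zero_mul] at this
    exact zero_ne_one this
  · intro x hx hne
    have : insert x t = S := by
      by_contra h
      exact right_ne_zero_of_smul hne (Pi.single_eq_of_ne h _)
    subst this
    rw [Pi.smul_apply, Finset.erase_insert (by simpa using hx), Pi.single_eq_same,
      Pi.single_eq_same, insSign_insert_of_not_lt F t (lt_irrefl x)]

theorem bd_toFun (k m : ℕ) (c : Chains F V k (m + 1)) :
    bd F (toFun F V k (m + 1) c) = toFun F V k m (boundary F V k m c) := by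
  induction c using chains_induction with
  | h0 => simp only [map_zero]
  | hs σ x =>
    rw [toFun_single, bd_single, boundary_single, map_sum]
    conv_lhs => rw [Simplex.verts, Finset.sum_image σ.val_injective.injOn]
    refine Finset.sum_congr rfl fun i _ => ?_
    rw [map_smul, toFun_single, toExt_inclusion, Simplex.verts_face, ← σ.insSign_verts i]
    rfl
  | ha x y hx hy => simp only [map_add, hx, hy]

theorem ker_boundary_le_range [FiniteDimensional F V] {k m : ℕ} (hk : 1 ≤ k)
    (hm : m + 1 + k < finrank F V) :
    LinearMap.ker (boundary F V k m) ≤ LinearMap.range (boundary F V k (m + 1)) := by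
  intro c hc
  obtain ⟨w, hw, hwm, hwd⟩ := exactIn_bldCoeff _ ⊤ k (m + 1) (finrank_top F V) hm _
    (toFun_mem k _ c) (toFun_card k _ c) (by rw [bd_toFun, LinearMap.mem_ker.1 hc, map_zero])
  obtain ⟨c', rfl⟩ := exists_toFun_eq hk hw hwm
  exact ⟨c', toFun_injective k _ (by rw [← bd_toFun, hwd])⟩

/-- Exactness at the empty simplex, where every chain is a cycle. -/
theorem range_boundary_zero [FiniteDimensional F V] {k : ℕ} (hk : 1 ≤ k)
    (hm : k < finrank F V) : LinearMap.range (boundary F V k 0) = ⊤ := by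
  refine eq_top_iff.2 fun c _ => ?_
  obtain ⟨w, hw, hwm, hwd⟩ := exactIn_bldCoeff _ ⊤ k 0 (finrank_top F V) (by omega) _
    (toFun_mem k _ c) (toFun_card k _ c) (by
      ext1 s
      refine Finset.sum_eq_zero fun x _ => ?_
      by_contra h
      have := toFun_card k _ c _ (right_ne_zero_of_smul h)
      rw [Finset.card_eq_zero] at this
      exact Finset.insert_ne_empty _ _ this)
  obtain ⟨c', rfl⟩ := exists_toFun_eq hk hw hwm
  exact ⟨c', toFun_injective k _ (by rw [← bd_toFun, hwd])⟩

end Comparison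

/-! ### The characteristic polynomial of the lattice of subspaces -/

section Counting

variable {F : Type*} [Field F] {V : Type*} [AddCommGroup V] [Module F V]

theorem linearIndependent_iff_span_transpose {d s : ℕ} (r : Matrix (Fin d) (Fin s) F) :
    LinearIndependent F r.row ↔ Submodule.span F (Set.range r.col) = ⊤ := by
  rw [linearIndependent_iff_card_eq_finrank_span, Set.finrank, ← Matrix.rank_eq_finrank_span_row,
    Matrix.rank_eq_finrank_span_cols]
  constructor
  · intro h
    refine Submodule.eq_top_of_finrank_eq ?_
    rw [← h, finrank_fintype_fun_eq_card]
  · intro h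
    rw [h, finrank_top, finrank_fintype_fun_eq_card]

/-- For $d>s$ both sides are 0, the product through its factor $i=s$; so no bound on $s$ is needed
later. -/
theorem card_linearIndependent_int [Finite F] (d s : ℕ) :
    (Nat.card {r : Fin d → Fin s → F // LinearIndependent F r} : ℤ) =
      ∏ i ∈ Finset.range d, ((Nat.card F : ℤ) ^ s - (Nat.card F : ℤ) ^ i) := by
  let _ := Fintype.ofFinite F
  have hq : Fintype.card F = Nat.card F := Nat.card_eq_fintype_card.symm
  have hfr : finrank F (Fin s → F) = s := by simp
  by_cases h : d ≤ s
  · rw [card_linearIndependent (by rw [hfr]; exact h), hfr, hq, Finset.prod_range]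
    push_cast
    refine Finset.prod_congr rfl fun i _ => ?_
    rw [Nat.cast_sub (Nat.pow_le_pow_right Nat.card_pos (by omega))]
    push_cast
    rfl
  · rw [Finset.prod_eq_zero (Finset.mem_range.2 (not_le.1 h)) (sub_self _)]
    have : IsEmpty {r : Fin d → Fin s → F // LinearIndependent F r} :=
      ⟨fun r => h (by simpa using r.2.fintype_card_le_finrank)⟩
    simp

/-- In coordinates the tuple forms the columns of a matrix, and these span exactly when its rows are
independent. -/
theorem card_spanning [Finite F] [FiniteDimensional F V] (s : ℕ) :
    (Nat.card {v : Fin s → V // Submodule.span F (Set.range v) = ⊤} : ℤ) =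
      ∏ i ∈ Finset.range (finrank F V), ((Nat.card F : ℤ) ^ s - (Nat.card F : ℤ) ^ i) := by
  rw [← card_linearIndependent_int]
  congr 1
  let b : V ≃ₗ[F] (Fin (finrank F V) → F) := (finBasis F V).equivFun
  let e : (Fin s → V) ≃ (Fin (finrank F V) → Fin s → F) :=
    (Equiv.piCongrRight fun _ => b.toEquiv).trans (Equiv.piComm _)
  refine Nat.card_congr (e.subtypeEquiv fun v => ?_)
  have h := linearIndependent_iff_span_transpose (Matrix.of (e v))
  have hcol : (Matrix.of (e v)).col = b ∘ v := rfl
  rw [hcol, Set.range_comp, ← LinearEquiv.coe_coe, ← Submodule.map_span] at h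
  refine Iff.trans ?_ h.symm
  constructor
  · intro h
    rw [h, Submodule.map_top, LinearEquiv.range]
  · intro h
    refine Submodule.map_injective_of_injective b.injective ?_
    rw [h, Submodule.map_top, LinearEquiv.range]

theorem card_span_eq [Finite F] [FiniteDimensional F V] (U : Submodule F V) (s : ℕ) :
    (Nat.card {v : Fin s → V // Submodule.span F (Set.range v) = U} : ℤ) =
      ∏ i ∈ Finset.range (finrank F U), ((Nat.card F : ℤ) ^ s - (Nat.card F : ℤ) ^ i) := by
  rw [← card_spanning (V := U)]
  congr 1
  have hspan : ∀ v : Fin s → U, (Submodule.span F (Set.range v)).map U.subtype =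
      Submodule.span F (Set.range fun i => (v i : V)) := by
    intro v
    rw [Submodule.map_span, ← Set.range_comp]
    rfl
  refine (Nat.card_congr (Equiv.ofBijective
    (fun v => ⟨fun i => (v.1 i : V), by
      rw [← hspan, v.2, Submodule.map_top, Submodule.range_subtype]⟩) ⟨?_, ?_⟩)).symm
  · intro v w h
    ext i
    exact congrFun (congrArg Subtype.val h) i
  · rintro ⟨v, hv⟩
    refine ⟨⟨fun i => ⟨v i, hv ▸ Submodule.subset_span ⟨i, rfl⟩⟩, ?_⟩, rfl⟩
    refine Submodule.map_injective_of_injective U.subtype_injective ?_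
    rw [hspan, Submodule.map_top, Submodule.range_subtype]
    exact hv

variable [Fintype (Submodule F V)]

/-- Count the `s`-tuples of vectors of $X$ according to their span. -/
theorem sum_prod_pow_sub_pow [Finite F] [FiniteDimensional F V] (X : Submodule F V) (s : ℕ) :
    ∑ U ∈ Finset.univ.filter (· ≤ X), ∏ i ∈ Finset.range (finrank F U),
      ((Nat.card F : ℤ) ^ s - (Nat.card F : ℤ) ^ i) = ((Nat.card F : ℤ) ^ s) ^ finrank F X := by
  have : Finite V := Module.finite_of_finite F
  let _ := Fintype.ofFinite V
  have h1 : (Finset.univ.filter fun v : Fin s → V => ∀ i, v i ∈ X).card =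
      (Nat.card F ^ s) ^ finrank F X := by
    rw [← Fintype.card_subtype, ← Nat.card_eq_fintype_card,
      Nat.card_congr (Equiv.subtypePiEquivPi (p := fun _ v => v ∈ X)), Nat.card_fun,
      Nat.card_eq_fintype_card (α := Fin s), Fintype.card_fin]
    rw [show Nat.card {v // v ∈ X} = _ from Module.natCard_eq_pow_finrank (K := F) (V := X)]
    ring
  rw [← Nat.cast_pow, ← Nat.cast_pow, ← h1, Finset.card_eq_sum_card_fiberwise
    (f := fun v => Submodule.span F (Set.range v)) (t := Finset.univ.filter (· ≤ X))]
  · push_cast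
    refine Finset.sum_congr rfl fun U hU => ?_
    rw [← card_span_eq, Nat.card_eq_fintype_card, Fintype.card_subtype]
    congr 2
    ext v
    simp only [Finset.mem_filter, Finset.mem_univ, true_and] at hU ⊢
    refine ⟨fun h => ⟨fun i => hU ?_, h⟩, fun h => h.2⟩
    rw [← h]
    exact Submodule.subset_span ⟨i, rfl⟩
  · intro v hv
    simp only [Finset.coe_filter, Finset.mem_univ, true_and, Set.mem_ofPred_eq] at hv ⊢
    refine Submodule.span_le.2 ?_
    rintro _ ⟨i, rfl⟩
    exact hv i

open Polynomial in
-- The two polynomials agree at the infinitely many points $T=q^s$.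
theorem sum_prod_X_sub_pow [Finite F] [FiniteDimensional F V] (X : Submodule F V) :
    ∑ U ∈ Finset.univ.filter (· ≤ X), ∏ i ∈ Finset.range (finrank F U),
      ((Polynomial.X : ℤ[X]) - C ((Nat.card F : ℤ) ^ i)) = Polynomial.X ^ finrank F X := by
  refine Polynomial.eq_of_infinite_eval_eq _ _ ?_
  have hq : 1 < Nat.card F := Finite.one_lt_card
  refine (Set.infinite_range_of_injective (f := fun s : ℕ => (Nat.card F : ℤ) ^ s) ?_).mono ?_
  · exact Int.pow_right_injective (by exact_mod_cast hq)
  · rintro _ ⟨s, rfl⟩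
    simp only [Set.mem_ofPred_eq]
    rw [eval_finsetSum, eval_pow, eval_X, ← sum_prod_pow_sub_pow X s]
    refine Finset.sum_congr rfl fun U _ => ?_
    rw [eval_prod]
    simp

/-! ### Alternating sums over chains. -/

variable (F V) in
/-- The chains of subspaces properly contained in `X`. -/
def chainsBelow (X : Submodule F V) : Finset (Finset (Submodule F V)) :=
  Finset.univ.filter fun s => IsChain (· ≤ ·) (s : Set (Submodule F V)) ∧ ∀ U ∈ s, U < X

theorem mem_chainsBelow {X : Submodule F V} {s : Finset (Submodule F V)} :
    s ∈ chainsBelow F V X ↔ IsChain (· ≤ ·) (s : Set (Submodule F V)) ∧ ∀ U ∈ s, U < X := by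
  simp [chainsBelow]

open Polynomial in
/-- The alternating sum of `T ^ dim U₀` over the chains `U₀ ⊊ ⋯ ⊊ X`. -/
def chainPoly (X : Submodule F V) : ℤ[X] :=
  ∑ s ∈ chainsBelow F V X, (-1) ^ s.card * Polynomial.X ^ finrank F (X ⊓ s.inf id : Submodule F V)

open Polynomial in
-- The empty chain gives the power of $T$; the other chains are grouped by their largest member $U$,
-- whose removal changes the sign.
theorem chainPoly_eq_sub (X : Submodule F V) :
    chainPoly X = Polynomial.X ^ finrank F X - ∑ U ∈ Finset.univ.filter (· < X), chainPoly U := by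
  have h0 : ∅ ∈ chainsBelow F V X := by simp [mem_chainsBelow]
  rw [chainPoly, ← Finset.add_sum_erase _ _ h0, sub_eq_add_neg]
  congr 1
  · rw [Finset.inf_empty, inf_top_eq]
    simp
  rw [← Finset.sum_fiberwise_of_maps_to (t := Finset.univ.filter (· < X)) (g := fun s => s.sup id),
    ← Finset.sum_neg_distrib]
  · refine Finset.sum_congr rfl fun U hU => ?_
    rw [Finset.mem_filter] at hU
    rw [chainPoly, ← Finset.sum_neg_distrib]
    refine Finset.sum_bij' (fun s _ => s.erase U) (fun s _ => insert U s) ?_ ?_ ?_ ?_ ?_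
    · intro s hs
      simp only [Finset.mem_filter, Finset.mem_erase, mem_chainsBelow] at hs ⊢
      refine ⟨hs.1.2.1.mono (by simp), fun W hW => ?_⟩
      refine lt_of_le_of_ne ?_ hW.1
      rw [← hs.2]
      exact Finset.le_sup (f := id) hW.2
    · intro s hs
      simp only [Finset.mem_filter, Finset.mem_erase, mem_chainsBelow] at hs ⊢
      refine ⟨⟨by simp, ?_, ?_⟩, ?_⟩
      · rw [Finset.coe_insert]
        exact hs.1.insert fun W hW _ => Or.inr (hs.2 W hW).le
      · intro W hW
        rcases Finset.mem_insert.1 hW with rfl | hW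
        · exact hU.2
        · exact (hs.2 W hW).trans hU.2
      · rw [Finset.sup_insert, id]
        exact sup_eq_left.2 (Finset.sup_le fun W hW => (hs.2 W hW).le)
    · intro s hs
      simp only [Finset.mem_filter, Finset.mem_erase, mem_chainsBelow] at hs
      refine Finset.insert_erase ?_
      rw [← hs.2]
      exact sup_mem_of_isChain (Finset.nonempty_iff_ne_empty.2 hs.1.1) hs.1.2.1
    · intro s hs
      rw [mem_chainsBelow] at hs
      exact Finset.erase_insert fun h => lt_irrefl U (hs.2 U h)
    · intro s hs
      simp only [Finset.mem_filter, Finset.mem_erase, mem_chainsBelow] at hs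
      have hUs : U ∈ s := by
        rw [← hs.2]
        exact sup_mem_of_isChain (Finset.nonempty_iff_ne_empty.2 hs.1.1) hs.1.2.1
      have h1 : X ⊓ s.inf id = U ⊓ (s.erase U).inf id := by
        conv_lhs => rw [← Finset.insert_erase hUs, Finset.inf_insert, id]
        exact inf_eq_right.2 (inf_le_left.trans hU.2.le)
      rw [h1, ← Finset.card_erase_add_one hUs, pow_succ]
      ring
  · intro s hs
    simp only [Finset.mem_filter, Finset.mem_erase, mem_chainsBelow, Finset.mem_univ,
      true_and] at hs ⊢
    exact hs.2.2 _ (sup_mem_of_isChain (Finset.nonempty_iff_ne_empty.2 hs.1) hs.2.1)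

open Polynomial in
-- By `sum_prod_X_sub_pow` the products satisfy the recursion of `chainPoly_eq_sub`, which
-- determines them.
theorem chainPoly_eq_prod [Finite F] [FiniteDimensional F V] (X : Submodule F V) :
    chainPoly X = ∏ i ∈ Finset.range (finrank F X),
      ((Polynomial.X : ℤ[X]) - C ((Nat.card F : ℤ) ^ i)) := by
  induction X using WellFoundedLT.induction with
  | ind X ih =>
  rw [chainPoly_eq_sub, ← sum_prod_X_sub_pow X, sub_eq_iff_eq_add]
  have h : Finset.univ.filter (· ≤ X) = insert X (Finset.univ.filter (· < X)) := by
    ext U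
    simp [le_iff_eq_or_lt]
  rw [h, Finset.sum_insert (by simp)]
  congr 1
  exact Finset.sum_congr rfl fun U hU => (ih U (Finset.mem_filter.1 hU).2).symm

theorem sum_chainsBelow_choose [Finite F] [FiniteDimensional F V] (X : Submodule F V) (k : ℕ)
    (hk : 1 ≤ k) (hkn : k ≤ finrank F X) :
    ∑ s ∈ chainsBelow F V X, (-1 : ℤ) ^ s.card *
        ((finrank F (X ⊓ s.inf id : Submodule F V)).choose k : ℤ) =
      (-1) ^ (finrank F X - k) *
        ∑ α ∈ Finset.powersetCard (finrank F X - k) (Finset.Icc 1 (finrank F X - 1)),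
          ∏ j ∈ α, ((Nat.card F : ℤ) ^ j - 1) := by
  -- The shift $T\mapsto T+1$ produces binomial coefficients on one side and factors $T+(1-q^i)$ on
  -- the other.
  have h := congrArg (fun p => (p.comp (Polynomial.X + 1)).coeff k) (chainPoly_eq_prod X)
  simp only [chainPoly] at h
  rw [Polynomial.sum_comp, Polynomial.finsetSum_coeff, Polynomial.prod_comp] at h
  have h1 : ∀ i, ((Polynomial.X : Polynomial ℤ) - Polynomial.C ((Nat.card F : ℤ) ^ i)).comp
      (Polynomial.X + 1) = Polynomial.X + Polynomial.C (1 - (Nat.card F : ℤ) ^ i) := by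
    intro i
    simp
    ring
  simp only [h1] at h
  rw [Finset.prod_X_add_C_coeff _ _ (by simpa using hkn), Finset.card_range] at h
  have h2 : ∀ s : Finset (Submodule F V), (((-1 : Polynomial ℤ) ^ s.card *
      Polynomial.X ^ finrank F (X ⊓ s.inf id : Submodule F V)).comp (Polynomial.X + 1)).coeff k =
      (-1 : ℤ) ^ s.card * ((finrank F (X ⊓ s.inf id : Submodule F V)).choose k : ℤ) := by
    intro s
    have h3 : (-1 : Polynomial ℤ) ^ s.card = Polynomial.C ((-1) ^ s.card) := by simp
    rw [h3, Polynomial.mul_comp, Polynomial.C_comp, Polynomial.pow_comp, Polynomial.X_comp,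
      Polynomial.coeff_C_mul, Polynomial.coeff_X_add_one_pow]
  simp only [h2] at h
  rw [h, Finset.mul_sum]
  symm
  -- Index sets containing 0 contribute nothing because $1-q^0=0$; this is why the $\alpha_j$ start
  -- at 1.
  refine Finset.sum_subset_zero_on_sdiff (Finset.powersetCard_mono fun i hi => ?_) ?_ ?_
  · simp only [Finset.mem_Icc, Finset.mem_range] at hi ⊢
    omega
  · intro α hα
    simp only [Finset.mem_sdiff, Finset.mem_powersetCard, not_and'] at hα
    have h0 : 0 ∈ α := by
      by_contra h0
      refine hα.2 hα.1.2 fun i hi => ?_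
      have h4 := Finset.mem_range.1 (hα.1.1 hi)
      have h5 : i ≠ 0 := fun h => h0 (h ▸ hi)
      rw [Finset.mem_Icc]
      omega
    exact Finset.prod_eq_zero h0 (by simp)
  · intro α hα
    rw [← (Finset.mem_powersetCard.1 hα).2, ← Finset.prod_const, ← Finset.prod_mul_distrib]
    exact Finset.prod_congr rfl fun i _ => by ring

end Counting

/-! ### Dimensions -/

section Dimension

variable {F : Type*} [Field F] {V : Type*} [AddCommGroup V] [Module F V] [FiniteDimensional F V]

theorem Simplex.add_finrank_le {m : ℕ} (σ : Simplex F V (m + 1)) (i : Fin (m + 1)) :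
    finrank F (σ 0).1 + i ≤ finrank F (σ i).1 := by
  induction i using Fin.induction with
  | zero => simp
  | succ i ih =>
    have h : (σ i.castSucc).1 < (σ i.succ).1 := σ.strictMono Fin.castSucc_lt_succ
    have := Submodule.finrank_lt_finrank_of_lt h
    simp only [Fin.val_castSucc, Fin.val_succ] at ih ⊢
    omega

theorem Simplex.finrank_coeff_add_le {m : ℕ} (σ : Simplex F V m) :
    finrank F (coeff σ) + m ≤ finrank F V := by
  cases m with
  | zero => exact (Submodule.finrank_le _)
  | succ m =>
    have h1 := σ.add_finrank_le (Fin.last m)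
    have h2 := Submodule.finrank_lt (σ (Fin.last m)).2.2
    have h3 : finrank F (coeff σ) = finrank F (σ 0).1 := rfl
    rw [Fin.val_last] at h1
    omega

variable [Finite (Submodule F V)]

instance (m : ℕ) : Finite (Simplex F V m) := DFunLike.finite _

instance (m : ℕ) : Fintype (Simplex F V m) := Fintype.ofFinite _

instance (k m : ℕ) : Module.Finite F (Chains F V k m) :=
  inferInstanceAs (Module.Finite F (⨁ σ : Simplex F V m, ⋀[F]^k (coeff σ)))

theorem finrank_chains (k m : ℕ) :
    finrank F (Chains F V k m) = ∑ σ : Simplex F V m, (finrank F (coeff σ)).choose k := by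
  have h : finrank F (Chains F V k m) = finrank F (⨁ σ : Simplex F V m, ⋀[F]^k (coeff σ)) := rfl
  rw [h, Module.finrank_directSum]
  exact Finset.sum_congr rfl fun σ _ => exteriorPower.finrank_eq F k

theorem finrank_chains_eq_zero {k m : ℕ} (h : finrank F V < m + k) :
    finrank F (Chains F V k m) = 0 := by
  rw [finrank_chains]
  refine Finset.sum_eq_zero fun σ _ => Nat.choose_eq_zero_of_lt ?_
  have := σ.finrank_coeff_add_le
  omega

/-- The chains on the right that are not simplices contain the zero subspace, and $\binom0k=0$.
Simplices with more than $n-k$ vertices have $\dim U_0<k$ and also contribute 0. -/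
theorem sum_finrank_chains [Fintype (Submodule F V)] {k : ℕ} (hk : 1 ≤ k) :
    ∑ m ∈ Finset.range (finrank F V - k + 1), (-1 : ℤ) ^ m * (finrank F (Chains F V k m) : ℤ) =
      ∑ s ∈ chainsBelow F V ⊤, (-1 : ℤ) ^ s.card *
        ((finrank F (⊤ ⊓ s.inf id : Submodule F V)).choose k : ℤ) := by
  have hne : ∀ s ∈ chainsBelow F V ⊤, ((-1 : ℤ) ^ s.card *
      ((finrank F (⊤ ⊓ s.inf id : Submodule F V)).choose k : ℤ)) ≠ 0 →
      (∃ σ : Simplex F V s.card, σ.verts = s) := by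
    intro s hs h0
    rw [mem_chainsBelow] at hs
    refine Simplex.exists_verts_eq hs.1 fun U hU => ⟨?_, (hs.2 U hU).ne⟩
    rintro rfl
    rw [top_inf_eq, le_bot_iff.1 (Finset.inf_le (f := id) hU), finrank_bot,
      Nat.choose_eq_zero_of_lt (by omega)] at h0
    simp at h0
  rw [← Finset.sum_filter_ne_zero (s := chainsBelow F V ⊤),
    ← Finset.sum_fiberwise_of_maps_to (t := Finset.range (finrank F V - k + 1))
      (g := Finset.card)]
  · refine Finset.sum_congr rfl fun m _ => ?_
    rw [finrank_chains, Nat.cast_sum, Finset.mul_sum]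
    refine Finset.sum_bij_ne_zero (fun σ _ _ => σ.verts) ?_ ?_ ?_ ?_
    · intro σ _ h
      simp only [Finset.mem_filter, mem_chainsBelow, σ.card_verts]
      refine ⟨⟨⟨σ.isChain_verts, fun U hU => ?_⟩, by rwa [top_inf_eq, σ.inf_verts]⟩,
        trivial⟩
      obtain ⟨i, -, rfl⟩ := Finset.mem_image.1 hU
      exact lt_top_iff_ne_top.2 (σ i).2.2
    · exact fun σ _ _ τ _ _ h => Simplex.verts_injective m h
    · intro s hs h
      rw [Finset.mem_filter, Finset.mem_filter] at hs
      obtain ⟨σ, hσ⟩ := hne s hs.1.1 h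
      obtain rfl := hs.2
      refine ⟨σ, Finset.mem_univ _, ?_, hσ⟩
      rw [← hσ, top_inf_eq, σ.inf_verts] at h
      rwa [σ.card_verts] at h
    · intro σ _ _
      rw [σ.card_verts, top_inf_eq, σ.inf_verts]
  · intro s hs
    rw [Finset.mem_filter] at hs
    obtain ⟨σ, hσ⟩ := hne s hs.1 hs.2
    have h1 := σ.finrank_coeff_add_le
    have h2 : k ≤ finrank F (coeff σ) := by
      by_contra h
      apply hs.2
      rw [top_inf_eq, ← σ.inf_verts.symm.trans (congrArg (fun t => t.inf id) hσ),
        Nat.choose_eq_zero_of_lt (not_le.1 h)]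
      simp
    rw [Finset.mem_range]
    omega

/-- Rank–nullity telescopes, since exactness identifies each kernel with the next range. -/
theorem alternating_sum_finrank {k : ℕ} (hk : 1 ≤ k) (M : ℕ) (hM : M + k < finrank F V) :
    ∑ m ∈ Finset.range (M + 1), (-1 : ℤ) ^ m * (finrank F (Chains F V k m) : ℤ) =
      (-1) ^ M * (finrank F (LinearMap.range (boundary F V k M)) : ℤ) := by
  let _ := Fintype.ofFinite (Submodule F V)
  induction M with
  | zero =>
    rw [range_boundary_zero hk (by omega), finrank_top]
    simp
  | succ M ih =>
    rw [Finset.sum_range_succ, ih (by omega),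
      ← LinearMap.finrank_range_add_finrank_ker (boundary F V k M)]
    have h : LinearMap.ker (boundary F V k M) = LinearMap.range (boundary F V k (M + 1)) :=
      le_antisymm (ker_boundary_le_range hk hM)
        (LinearMap.range_le_ker_iff.2 (boundary_boundary F V k M))
    rw [h]
    push_cast
    ring

theorem finrank_D {k : ℕ} (hk : 1 ≤ k) (hkn : k < finrank F V) :
    (-1 : ℤ) ^ (finrank F V - k) * (finrank F (D F V k) : ℤ) =
      ∑ m ∈ Finset.range (finrank F V - k + 1),
        (-1 : ℤ) ^ m * (finrank F (Chains F V k m) : ℤ) := by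
  obtain ⟨N, hN⟩ : ∃ N, finrank F V - k = N + 1 := ⟨finrank F V - k - 1, by omega⟩
  have hD : finrank F (D F V k) = finrank F (LinearMap.ker (boundary F V k N)) := by
    unfold D
    rw [hN, Nat.add_sub_cancel]
    -- There are no chains above the top degree, so the homology is the kernel itself.
    have h0 : Subsingleton (Chains F V k (N + 1 + 1)) :=
      finrank_zero_iff.1 (finrank_chains_eq_zero (by omega))
    have h1 : LinearMap.range (boundary F V k (N + 1)) = ⊥ := by
      rw [LinearMap.range_eq_bot]
      ext1 x
      rw [Subsingleton.elim x 0, map_zero, map_zero]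
    refine (Submodule.quotEquivOfEqBot _ ?_).finrank_eq
    rw [h1, Submodule.submoduleOf, Submodule.comap_bot, Submodule.ker_subtype]
  rw [hD, hN, Finset.sum_range_succ, alternating_sum_finrank hk N (by omega),
    ← LinearMap.finrank_range_add_finrank_ker (boundary F V k N)]
  push_cast
  ring

end Dimension

end Building

end

theorem theorem1p5 {F : Type*} [Field F] [Finite F]
    {V : Type*} [AddCommGroup V] [Module F V] [FiniteDimensional F V]
    (q n k : ℕ) (hq : Nat.card F = q) (hn : Module.finrank F V = n)
    (hk : 1 ≤ k) (hkn : k < n) :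
    (Module.finrank F (Building.D F V k) : ℤ) =
      ∑ α ∈ Finset.powersetCard (n - k) (Finset.Icc 1 (n - 1)),
        ∏ j ∈ α, ((q : ℤ) ^ j - 1) := by
  subst hq hn
  have : Finite V := Module.finite_of_finite F
  let _ := Fintype.ofFinite (Submodule F V)
  have h := Building.sum_chainsBelow_choose (⊤ : Submodule F V) k hk
    (by rw [finrank_top]; exact hkn.le)
  rw [← Building.sum_finrank_chains hk, ← Building.finrank_D hk hkn, finrank_top] at h
  exact mul_left_cancel₀ (pow_ne_zero _ (by norm_num)) h
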